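/- Let $(\Omega,\mathcal F,\mathbb P)$ be a probability space and $h=(h_i)_{i\ge 1}$ a random external field whose components are independent copies of a real random variable $h_0$ satisfying - (A1) $\mathbb E h_0^2<\infty$ and $\mathbb V h_0>0$; - (A2) $\mathbb E h_0^4<\infty$ and $\mathbb V(h_0^2)>0$. Let $J>0$, $\beta>0$. For $n\ge 1$ let $\mu_n=\mu_n^{\beta,J,h}$ be the (random) finite volume Gibbs state $$\mu_n(d\phi)=\frac{e^{-\beta H_n[\phi]}}{\int e^{-\beta H_n}\,d\omega_n}\,\omega_n(d\phi),\qquad H_n[\phi]=-\frac{J}{2n}\sum_{i,j=1}^n\phi_i\phi_j-\sum_{i=1}^n h_i\phi_i,$$ where $\omega_n$ is the uniform probability measure on the sphere of radius $\sqrt n$ in $\mathbb R^n$ (all other coordinates are $0$ when $\mu_n$ is viewed on $\mathbb R^{\mathbb N}$). Put $M_n[\phi]=\sum_{i=1}^n\phi_i$, and let $X_n:=\mu_n[M_n/n]$ be the magnetization density, a random variable through $h$. Put $m=(m^\parallel,m^\perp):=(\mathbb E h_0,\sqrt{\mathbb V h_0})$ and, for $z=(x,y)$ in the open unit disc $B(0,1)\subset\mathbb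 R^2$, $$\psi(z)=\frac{\beta J}{2}x^2+\beta\langle m,z\rangle+\frac12\ln(1-\|z\|^2),$$ and let $M^*$ be the set of global maximizing points of $\psi$ on $B(0,1)$. The pure state range is the set of parameters for which $M^*$ has exactly one element $z^*=(x^*,y^*)$, and the mixed state range the set of parameters for which $M^*$ has exactly two elements. Let $\beta_c:=J/((J-m^\perp)(J+m^\perp))$ when $m^\perp<J$. Then each $X_n$ is a square integrable random variable, and the following hold. 1. In the pure state range, $\lim_{n\to\infty}\mathbb E f(X_n)=f(x^*)$ for every $f\in C_b(\mathbb R)$; moreover $\mathbb E X_n\to x^*$ and $\mathbb V X_n\to 0$. 2. In the mixed state range, $M^*=\{z^+,z^-\}$ with $x^+>0$, $x^-=-x^+$ and $y^-=y^+$, and $\lim_{n\to\infty}\mathbb E f(X_n)=\tfrac12 f(x^+)+\tfrac12 f(x^-)$ for every $f\in C_b(\mathbb R)$; moreover $\mathbb E X_n\to 0$ and $\mathbb V X_n\to (x^+)^2>0$. 3. The parameters lie in the mixed state range if and only if $m^\parallel=0$, $m^\perp<J$ and $\beta>\beta_c$; in all other cases (that is, $m^\parallel\ne0$, or $m^\perp\ge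 J$, or $m^\perp<J$ and $\beta\le\beta_c$), and only then, they lie in the pure state range. 4. Call the model an ordered ferromagnet if $\mathbb E X_n$ tends to a nonzero limit and $\mathbb V X_n\to0$; an ordered paramagnet if $\mathbb E X_n\to0$ and $\mathbb V X_n\to 0$; a spin glass if $\mathbb E X_n\to0$ and $\mathbb V X_n$ tends to a positive limit. Then the model is an ordered ferromagnet if and only if $\mathbb E h_0\neq0$; an ordered paramagnet if and only if $\mathbb E h_0=0$ and either $m^\perp\ge J$, or $m^\perp<J$ and $\beta\le\beta_c$; and a spin glass if and only if $\mathbb E h_0=0$, $m^\perp<J$ and $\beta>\beta_c$. -/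

import Mathlib

open MeasureTheory ProbabilityTheory Filter Topology BoundedContinuousFunction

noncomputable section

namespace MeanFieldSpherical

/-- The uniform probability measure on the sphere of radius `√n` in `ℝⁿ` (for `n ≥ 1`). -/
def sphereUniform (n : ℕ) : Measure (EuclideanSpace ℝ (Fin n)) :=
  (((volume : Measure (EuclideanSpace ℝ (Fin n))).toSphere Set.univ)⁻¹ •
    (volume : Measure (EuclideanSpace ℝ (Fin n))).toSphere).map
      (fun θ : Metric.sphere (0 : EuclideanSpace ℝ (Fin n)) 1 =>
        √(n : ℝ) • (θ : EuclideanSpace ℝ (Fin n)))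

/-- The mean-field Hamiltonian `-(J / 2n) ∑_{i,j} φ_i φ_j - ∑_i h_i φ_i`. -/
def hamiltonian (n : ℕ) (J : ℝ) (h : ℕ → ℝ) (φ : EuclideanSpace ℝ (Fin n)) : ℝ :=
  -(J / (2 * n)) * (∑ i : Fin n, ∑ j : Fin n, φ i * φ j) - ∑ i : Fin n, h i * φ i

/-- Extension of a finite configuration by `0`, giving an element of `ℝ^ℕ`. -/
def extendByZero (n : ℕ) (φ : EuclideanSpace ℝ (Fin n)) : ℕ → ℝ :=
  fun i => if hi : i < n then φ ⟨i, hi⟩ else 0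

/-- The finite volume Gibbs state `exp (-β H_n) / Z_n` times the uniform measure on the sphere,
as a measure on `ℝ^ℕ` that is concentrated at `0` in the coordinates outside the volume.
`Measure.tilted` is the density `exp (-β H_n) / ∫ exp (-β H_n)`. -/
def gibbsState (n : ℕ) (β J : ℝ) (h : ℕ → ℝ) : Measure (ℕ → ℝ) :=
  ((sphereUniform n).tilted (fun φ => -β * hamiltonian n J h φ)).map (extendByZero n)

/-- The magnetization `M_n`. -/
def magnetization (n : ℕ) (φ : ℕ → ℝ) : ℝ := ∑ i ∈ Finset.range n, φ i

/-- The magnetization density `μ_n[M_n / n]`. -/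
def magnetizationDensity (n : ℕ) (β J : ℝ) (h : ℕ → ℝ) : ℝ :=
  ∫ φ, magnetization n φ / n ∂(gibbsState n β J h)

/-- The open unit disc `B(0,1)` of the plane. -/
def unitDisc : Set (ℝ × ℝ) := {z | z.1 ^ 2 + z.2 ^ 2 < 1}

/-- The limiting exponential tilting function, with `m = (m^∥, m^⊥)` and `z = (x, y)`. -/
def tilting (β J : ℝ) (m z : ℝ × ℝ) : ℝ :=
  β * J / 2 * z.1 ^ 2 + β * (m.1 * z.1 + m.2 * z.2)
    + 1 / 2 * Real.log (1 - (z.1 ^ 2 + z.2 ^ 2))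

/-- The set `M^*` of global maximizing points of the tilting function on the open unit disc. -/
def maximizers (β J : ℝ) (m : ℝ × ℝ) : Set (ℝ × ℝ) :=
  {z | z ∈ unitDisc ∧ ∀ w ∈ unitDisc, tilting β J m w ≤ tilting β J m z}

/-- Pure state parameter range: there is exactly one global maximizing point. -/
def PureStateRange (β J : ℝ) (m : ℝ × ℝ) : Prop := (maximizers β J m).encard = 1

/-- Mixed state parameter range: there are exactly two global maximizing points. -/
def MixedStateRange (β J : ℝ) (m : ℝ × ℝ) : Prop := (maximizers β J m).encard = 2

/-- The critical inverse temperature (meaningful for `0 < s < J`). -/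
def criticalBeta (J s : ℝ) : ℝ := J / ((J - s) * (J + s))

section Random

variable {Ω Ω₀ : Type*} [MeasurableSpace Ω] [MeasurableSpace Ω₀]

/-- (A1): the components of `h` are independent copies of `h₀`, which is square integrable
and has positive variance. -/
structure AssumptionA1 (P : Measure Ω) (h : Ω → ℕ → ℝ) (P₀ : Measure Ω₀) (h₀ : Ω₀ → ℝ) :
    Prop where
  indep : iIndepFun (fun (i : ℕ) (ω : Ω) => h ω i) P
  identDistrib : ∀ i : ℕ, IdentDistrib (fun ω => h ω i) h₀ P P₀
  memLp_two : MemLp h₀ 2 P₀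
  variance_pos : 0 < Var[h₀; P₀]

/-- (A2): `h₀` has a finite fourth moment and `h₀ ^ 2` has positive variance. -/
structure AssumptionA2 (P₀ : Measure Ω₀) (h₀ : Ω₀ → ℝ) : Prop where
  memLp_four : MemLp h₀ 4 P₀
  variance_sq_pos : 0 < Var[fun ω => h₀ ω ^ 2; P₀]

/-- The limit `m = (E h₀, √(Var h₀))` of the sample mean and sample standard deviation. -/
def fieldParameters (P₀ : Measure Ω₀) (h₀ : Ω₀ → ℝ) : ℝ × ℝ :=
  (∫ ω, h₀ ω ∂P₀, √(Var[h₀; P₀]))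

/-- Ordered ferromagnet: the mean of the (random) magnetization density tends to a nonzero limit
and its variance tends to `0`. -/
def IsOrderedFerromagnet (P : Measure Ω) (X : ℕ → Ω → ℝ) : Prop :=
  (∃ c : ℝ, c ≠ 0 ∧ Tendsto (fun n => ∫ ω, X n ω ∂P) atTop (𝓝 c)) ∧
    Tendsto (fun n => Var[X n; P]) atTop (𝓝 0)

/-- Ordered paramagnet: mean and variance of the magnetization density both tend to `0`. -/
def IsOrderedParamagnet (P : Measure Ω) (X : ℕ → Ω → ℝ) : Prop :=
  Tendsto (fun n => ∫ ω, X n ω ∂P) atTop (𝓝 0) ∧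
    Tendsto (fun n => Var[X n; P]) atTop (𝓝 0)

/-- Spin glass: the mean of the magnetization density tends to `0` and its variance to a
positive limit. -/
def IsSpinGlass (P : Measure Ω) (X : ℕ → Ω → ℝ) : Prop :=
  Tendsto (fun n => ∫ ω, X n ω ∂P) atTop (𝓝 0) ∧
    ∃ v : ℝ, 0 < v ∧ Tendsto (fun n => Var[X n; P]) atTop (𝓝 v)

end Random

end MeanFieldSpherical

end

/-! ### The gnomonic chart and integration over a ball -/

namespace MeanFieldSpherical

open scoped ENNReal

/-! The energy sees a configuration only through its components along two orthonormal vectors: the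
normalized all-ones vector and the direction of the field minus its sample mean. So for n ≥ 3 the
magnetization density is a deterministic function of the sample mean and standard deviation of the
field (`magnetizationDensity_eq_planeMagnetization`). In the chart ζ ↦ ζ/√(1+|ζ|²) of the disc, the
projected uniform measure has density proportional to (1+|ζ|²)^(-n/2), so the Gibbs weight is
exactly exp(nψ), with ψ the tilting function at the sample parameters (`planeWeight_eq_exp`).

By Laplace's method these weights concentrate near the maximizers of the limiting ψ, even while the
parameters still move towards m (`tendsto_setIntegral_planeWeight_div`). The strong law makes the
sample parameters converge almost surely. With a single maximizer the magnetization density then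
converges almost surely to x*.

With two maximizers (±x, y) one has m^∥ = 0, and the fluctuations of the field decide. Reflecting
the first coordinate multiplies the weight by exp(-2β S_n x), where S_n is the sum of the field, so
the sign of S_n selects the maximizer once |S_n| is large (`tendsto_planeMagnetization_of_pair`). By
the central limit theorem |S_n| leaves every bounded set in probability and is positive with
probability tending to 1/2, which gives the two-point limit law.

For m^∥ ≥ 0, in the coordinates (x², y²) the function ψ is strictly concave on the quadrant, so it
has at most one maximizer with x ≥ 0 (`eq_of_mem_maximizers`); the other sign follows by reflection.
The critical point equations then locate β_c. Since |X_n| ≤ 1, convergence in law carries over to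
mean and variance, and uniqueness of limits separates the phases. -/

/-- The inverse gnomonic chart, from the plane to the open unit disc. -/
noncomputable def gnomonic (ζ : ℝ × ℝ) : ℝ × ℝ :=
  (ζ.1 / √(1 + (ζ.1 ^ 2 + ζ.2 ^ 2)), ζ.2 / √(1 + (ζ.1 ^ 2 + ζ.2 ^ 2)))

/-- The density `(1 + |ζ|²) ^ (-n / 2)` on the plane. -/
noncomputable def planeDensity (n : ℕ) (ζ : ℝ × ℝ) : ℝ :=
  ((√(1 + (ζ.1 ^ 2 + ζ.2 ^ 2)))⁻¹) ^ n

lemma one_add_sq_pos (ζ : ℝ × ℝ) : 0 < 1 + (ζ.1 ^ 2 + ζ.2 ^ 2) := by positivity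

lemma continuous_gnomonic : Continuous gnomonic := by
  unfold gnomonic
  refine Continuous.prodMk ?_ ?_ <;>
  · refine Continuous.div (by fun_prop) (by fun_prop) fun ζ => ?_
    exact (Real.sqrt_pos.2 (one_add_sq_pos ζ)).ne'

lemma continuous_planeDensity (n : ℕ) : Continuous (planeDensity n) := by
  unfold planeDensity
  refine Continuous.pow (Continuous.inv₀ (by fun_prop) fun ζ => ?_) n
  exact (Real.sqrt_pos.2 (one_add_sq_pos ζ)).ne'

lemma planeDensity_pos (n : ℕ) (ζ : ℝ × ℝ) : 0 < planeDensity n ζ :=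
  pow_pos (inv_pos.2 (Real.sqrt_pos.2 (one_add_sq_pos ζ))) n

lemma lintegral_comp_smul_addHaar {E : Type*} [NormedAddCommGroup E] [NormedSpace ℝ E]
    [MeasurableSpace E] [BorelSpace E] [FiniteDimensional ℝ E] (μ : Measure E)
    [μ.IsAddHaarMeasure] {r : ℝ} (hr : 0 < r) {g : E → ℝ≥0∞} (hg : Measurable g) :
    ∫⁻ x, g (r • x) ∂μ = ENNReal.ofReal (r⁻¹ ^ Module.finrank ℝ E) * ∫⁻ x, g x ∂μ := by
  rw [← lintegral_map hg (measurable_const_smul r), Measure.map_addHaar_smul μ hr.ne',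
    lintegral_smul_measure, smul_eq_mul, abs_of_pos (by positivity), inv_pow]

lemma lintegral_smul_left_addHaar {E : Type*} [NormedAddCommGroup E] [NormedSpace ℝ E]
    [MeasurableSpace E] [BorelSpace E] [FiniteDimensional ℝ E] (μ : Measure E)
    [μ.IsAddHaarMeasure] {r : ℝ} (hr : 0 < r) {g : E → ℝ≥0∞} (hg : Measurable g) :
    ∫⁻ x, g x ∂μ = ENNReal.ofReal (r ^ Module.finrank ℝ E) * ∫⁻ x, g (r • x) ∂μ := by
  rw [lintegral_comp_smul_addHaar μ hr hg, ← mul_assoc, ← ENNReal.ofReal_mul (by positivity),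
    ← mul_pow, mul_inv_cancel₀ hr.ne', one_pow, ENNReal.ofReal_one, one_mul]

section Gnomonic

variable {W : Type*} [NormedAddCommGroup W] [InnerProductSpace ℝ W] [FiniteDimensional ℝ W]
  [MeasurableSpace W] [BorelSpace W]

/-- Rescaling w by s = √(1+|ζ|²) turns the region into the unit ball. Lebesgue measure contributes s
to the power minus the dimension and the factor ‖w‖² contributes s⁻², whence the exponent `finrank +
2`. -/
lemma lintegral_fiber_gnomonic (ζ : ℝ × ℝ) :
    ∫⁻ w : W, {w : W | ‖w‖ ^ 2 * (1 + (ζ.1 ^ 2 + ζ.2 ^ 2)) < 1}.indicator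
        (fun w => ENNReal.ofReal (‖w‖ ^ 2)) w =
      ENNReal.ofReal (planeDensity (Module.finrank ℝ W + 2) ζ) *
        ∫⁻ w : W, {w : W | ‖w‖ < 1}.indicator (fun w => ENNReal.ofReal (‖w‖ ^ 2)) w := by
  have hs0 := one_add_sq_pos ζ
  set s := √(1 + (ζ.1 ^ 2 + ζ.2 ^ 2)) with hs
  have hspos : 0 < s := Real.sqrt_pos.2 hs0
  have hs2 : s ^ 2 = 1 + (ζ.1 ^ 2 + ζ.2 ^ 2) := Real.sq_sqrt hs0.le
  have hmeas : Measurable fun w : W => {w : W | ‖w‖ ^ 2 * (1 + (ζ.1 ^ 2 + ζ.2 ^ 2)) < 1}.indicator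
        (fun w => ENNReal.ofReal (‖w‖ ^ 2)) w :=
    (by fun_prop : Measurable fun w : W => ENNReal.ofReal (‖w‖ ^ 2)).indicator
      (measurableSet_lt (by fun_prop) (by fun_prop))
  rw [lintegral_smul_left_addHaar volume (inv_pos.2 hspos) hmeas]
  have key : ∀ w : W, {w : W | ‖w‖ ^ 2 * (1 + (ζ.1 ^ 2 + ζ.2 ^ 2)) < 1}.indicator
        (fun w => ENNReal.ofReal (‖w‖ ^ 2)) (s⁻¹ • w) =
      ENNReal.ofReal (s⁻¹ ^ 2) * {w : W | ‖w‖ < 1}.indicator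
        (fun w => ENNReal.ofReal (‖w‖ ^ 2)) w := by
    intro w
    have h1 : ‖s⁻¹ • w‖ ^ 2 = s⁻¹ ^ 2 * ‖w‖ ^ 2 := by
      rw [norm_smul, mul_pow, Real.norm_of_nonneg (inv_nonneg.2 hspos.le)]
    have h2 : s⁻¹ • w ∈ {w : W | ‖w‖ ^ 2 * (1 + (ζ.1 ^ 2 + ζ.2 ^ 2)) < 1} ↔
        w ∈ {w : W | ‖w‖ < 1} := by
      rw [Set.mem_ofPred_eq, Set.mem_ofPred_eq, h1, ← hs2]
      have : s⁻¹ ^ 2 * ‖w‖ ^ 2 * s ^ 2 = ‖w‖ ^ 2 := by field_simp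
      rw [this]
      exact pow_lt_one_iff_of_nonneg (norm_nonneg w) two_ne_zero
    by_cases hw : w ∈ {w : W | ‖w‖ < 1}
    · rw [Set.indicator_of_mem hw, Set.indicator_of_mem (h2.2 hw), h1,
        ENNReal.ofReal_mul (by positivity)]
    · rw [Set.indicator_of_notMem hw, Set.indicator_of_notMem (fun h => hw (h2.1 h)), mul_zero]
  simp_rw [key]
  rw [lintegral_const_mul _ ((by fun_prop : Measurable fun w : W =>
    ENNReal.ofReal (‖w‖ ^ 2)).indicator (measurableSet_lt (by fun_prop) (by fun_prop))),
    ← mul_assoc, ← ENNReal.ofReal_mul (by positivity), ← pow_add]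
  rfl

/-- For fixed w ≠ 0 substitute a = ‖w‖ζ, with Jacobian ‖w‖². The integrand becomes f(ζ), free of w,
and after Tonelli only the fiber integral over w remains. -/
lemma lintegral_ball_gnomonic [Nontrivial W] {f : ℝ × ℝ → ℝ≥0∞} (hf : Measurable f) :
    ∫⁻ p : (ℝ × ℝ) × W, {p : (ℝ × ℝ) × W | p.1.1 ^ 2 + p.1.2 ^ 2 + ‖p.2‖ ^ 2 < 1}.indicator
        (fun p => f (‖p.2‖⁻¹ • p.1)) p =
      (∫⁻ w : W, {w : W | ‖w‖ < 1}.indicator (fun w => ENNReal.ofReal (‖w‖ ^ 2)) w) *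
      ∫⁻ ζ : ℝ × ℝ, f ζ * ENNReal.ofReal (planeDensity (Module.finrank ℝ W + 2) ζ) := by
  have hmeas : Measurable fun p : (ℝ × ℝ) × W =>
      {p : (ℝ × ℝ) × W | p.1.1 ^ 2 + p.1.2 ^ 2 + ‖p.2‖ ^ 2 < 1}.indicator
        (fun p => f (‖p.2‖⁻¹ • p.1)) p := by
    refine Measurable.indicator (hf.comp (by fun_prop)) (measurableSet_lt (by fun_prop) (by fun_prop))
  have hmeas2 : Measurable fun p : W × (ℝ × ℝ) => f p.2 *
      {p : W × (ℝ × ℝ) | ‖p.1‖ ^ 2 * (1 + (p.2.1 ^ 2 + p.2.2 ^ 2)) < 1}.indicator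
        (fun p => ENNReal.ofReal (‖p.1‖ ^ 2)) p := by
    refine (hf.comp measurable_snd).mul (Measurable.indicator (by fun_prop)
      (measurableSet_lt (by fun_prop) (by fun_prop)))
  rw [Measure.volume_eq_prod (ℝ × ℝ) W, lintegral_prod_symm' _ hmeas]
  have h1 : ∀ᵐ w : W, (∫⁻ a : ℝ × ℝ,
      {p : (ℝ × ℝ) × W | p.1.1 ^ 2 + p.1.2 ^ 2 + ‖p.2‖ ^ 2 < 1}.indicator
        (fun p => f (‖p.2‖⁻¹ • p.1)) (a, w)) = ∫⁻ ζ : ℝ × ℝ, f ζ *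
      {p : W × (ℝ × ℝ) | ‖p.1‖ ^ 2 * (1 + (p.2.1 ^ 2 + p.2.2 ^ 2)) < 1}.indicator
        (fun p => ENNReal.ofReal (‖p.1‖ ^ 2)) (w, ζ) := by
    have h0 : ∀ᵐ w : W, w ≠ 0 := by
      rw [ae_iff]; simp
    filter_upwards [h0] with w hw
    have hw' : 0 < ‖w‖ := norm_pos_iff.2 hw
    have hw1 : Measurable fun a : ℝ × ℝ =>
        {p : (ℝ × ℝ) × W | p.1.1 ^ 2 + p.1.2 ^ 2 + ‖p.2‖ ^ 2 < 1}.indicator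
          (fun p => f (‖p.2‖⁻¹ • p.1)) (a, w) :=
      hmeas.comp (measurable_id.prodMk measurable_const)
    have hw2 : Measurable fun a : ℝ × ℝ =>
        {p : (ℝ × ℝ) × W | p.1.1 ^ 2 + p.1.2 ^ 2 + ‖p.2‖ ^ 2 < 1}.indicator
          (fun p => f (‖p.2‖⁻¹ • p.1)) (‖w‖ • a, w) :=
      hw1.comp (measurable_const_smul _)
    rw [lintegral_smul_left_addHaar volume hw' hw1, ← lintegral_const_mul _ hw2]
    refine lintegral_congr fun ζ => ?_
    have hfr : Module.finrank ℝ (ℝ × ℝ) = 2 := by simp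
    have hmem : ((‖w‖ • ζ, w) ∈ {p : (ℝ × ℝ) × W | p.1.1 ^ 2 + p.1.2 ^ 2 + ‖p.2‖ ^ 2 < 1}) ↔
        (w, ζ) ∈ {p : W × (ℝ × ℝ) | ‖p.1‖ ^ 2 * (1 + (p.2.1 ^ 2 + p.2.2 ^ 2)) < 1} := by
      simp only [Set.mem_ofPred_eq, Prod.smul_fst, Prod.smul_snd, smul_eq_mul]
      ring_nf
    by_cases hm : (w, ζ) ∈ {p : W × (ℝ × ℝ) | ‖p.1‖ ^ 2 * (1 + (p.2.1 ^ 2 + p.2.2 ^ 2)) < 1}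
    · rw [Set.indicator_of_mem hm, Set.indicator_of_mem (hmem.2 hm), hfr, smul_smul,
        inv_mul_cancel₀ hw'.ne', one_smul, mul_comm]
    · rw [Set.indicator_of_notMem hm, Set.indicator_of_notMem (fun h => hm (hmem.1 h))]
      simp
  rw [lintegral_congr_ae h1, lintegral_lintegral_swap hmeas2.aemeasurable]
  have h2 : ∀ ζ : ℝ × ℝ, (∫⁻ w : W, f ζ *
      {p : W × (ℝ × ℝ) | ‖p.1‖ ^ 2 * (1 + (p.2.1 ^ 2 + p.2.2 ^ 2)) < 1}.indicator
        (fun p => ENNReal.ofReal (‖p.1‖ ^ 2)) (w, ζ)) =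
      (∫⁻ w : W, {w : W | ‖w‖ < 1}.indicator (fun w => ENNReal.ofReal (‖w‖ ^ 2)) w) *
      (f ζ * ENNReal.ofReal (planeDensity (Module.finrank ℝ W + 2) ζ)) := by
    intro ζ
    have hζ : Measurable fun w : W => {w : W | ‖w‖ ^ 2 * (1 + (ζ.1 ^ 2 + ζ.2 ^ 2)) < 1}.indicator
        (fun w => ENNReal.ofReal (‖w‖ ^ 2)) w :=
      (by fun_prop : Measurable fun w : W => ENNReal.ofReal (‖w‖ ^ 2)).indicator
        (measurableSet_lt (by fun_prop) (by fun_prop))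
    refine (lintegral_const_mul (f ζ) hζ).trans ?_
    rw [mul_comm (lintegral _ _), mul_assoc, lintegral_fiber_gnomonic ζ,
      mul_comm (ENNReal.ofReal _)]
  simp_rw [h2]
  exact lintegral_const_mul _ (hf.mul (continuous_planeDensity _).measurable.ennreal_ofReal)

end Gnomonic

end MeanFieldSpherical

/-! ### Projection of the sphere measure to a plane -/

namespace MeanFieldSpherical

open scoped ENNReal

section Sphere

open scoped Pointwise

variable {E : Type*} [NormedAddCommGroup E] [InnerProductSpace ℝ E]

/-- Coordinates of a vector along two vectors. -/
def planeCoords (e₁ e₂ u : E) : ℝ × ℝ := (inner ℝ e₁ u, inner ℝ e₂ u)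

lemma continuous_planeCoords (e₁ e₂ : E) : Continuous (planeCoords e₁ e₂) := by
  unfold planeCoords; fun_prop

lemma planeCoords_smul (e₁ e₂ u : E) (r : ℝ) :
    planeCoords e₁ e₂ (r • u) = r • planeCoords e₁ e₂ u := by
  simp [planeCoords, inner_smul_right]

lemma Ioo_smul_image_sphere (s : Set (Metric.sphere (0 : E) 1)) :
    Set.Ioo (0 : ℝ) 1 • ((↑) '' s : Set E) =
      {u : E | ‖u‖ < 1 ∧ u ≠ 0 ∧ ‖u‖⁻¹ • u ∈ ((↑) '' s : Set E)} := by
  ext u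
  rw [Set.mem_smul]
  constructor
  · rintro ⟨r, hr, _, ⟨θ, hθ, rfl⟩, rfl⟩
    have hn : ‖r • (θ : E)‖ = r := by
      rw [norm_smul, norm_eq_of_mem_sphere, mul_one, Real.norm_of_nonneg hr.1.le]
    refine ⟨by rw [hn]; exact hr.2, ?_, ?_⟩
    · rw [← norm_pos_iff, hn]; exact hr.1
    · rw [hn, smul_smul, inv_mul_cancel₀ hr.1.ne', one_smul]
      exact ⟨θ, hθ, rfl⟩
  · rintro ⟨h1, h2, h3⟩
    have hu := norm_pos_iff.2 h2
    exact ⟨‖u‖, ⟨hu, h1⟩, _, h3, by rw [smul_smul, mul_inv_cancel₀ hu.ne', one_smul]⟩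

/-- For a vector of norm t with planar part a and orthogonal part of norm s, this passes from the
chart coordinate a/s to the planar part a/t of the normalized vector. -/
lemma gnomonic_div (a : ℝ × ℝ) {s t : ℝ} (hs : 0 < s) (ht : 0 < t)
    (h : t ^ 2 = a.1 ^ 2 + a.2 ^ 2 + s ^ 2) : gnomonic (s⁻¹ • a) = t⁻¹ • a := by
  have : √(1 + ((s⁻¹ • a).1 ^ 2 + (s⁻¹ • a).2 ^ 2)) = t / s := by
    rw [Real.sqrt_eq_iff_eq_sq (one_add_sq_pos _).le (div_pos ht hs).le, div_pow, h]
    simp only [Prod.smul_fst, Prod.smul_snd, smul_eq_mul]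
    field_simp
    ring
  unfold gnomonic
  rw [this]
  ext <;> simp only [Prod.smul_fst, Prod.smul_snd, smul_eq_mul] <;> field_simp

variable [FiniteDimensional ℝ E] [MeasurableSpace E] [BorelSpace E]

lemma exists_measurePreserving_split {k : ℕ} (b : OrthonormalBasis (Fin 2 ⊕ Fin k) ℝ E) :
    ∃ Φ : E → (ℝ × ℝ) × EuclideanSpace ℝ (Fin k), MeasurePreserving Φ ∧
      (∀ u, (Φ u).1 = planeCoords (b (.inl 0)) (b (.inl 1)) u) ∧
      ∀ u, ‖u‖ ^ 2 = (Φ u).1.1 ^ 2 + (Φ u).1.2 ^ 2 + ‖(Φ u).2‖ ^ 2 := by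
  refine ⟨fun u => ((b.repr u (.inl 0), b.repr u (.inl 1)),
    WithLp.toLp 2 fun i => b.repr u (.inr i)), ?_, fun u => ?_, fun u => ?_⟩
  · have h1 := b.measurePreserving_repr
    have h2 := PiLp.volume_preserving_ofLp (Fin 2 ⊕ Fin k)
    have h3 := volume_measurePreserving_sumPiEquivProdPi (fun _ : Fin 2 ⊕ Fin k => ℝ)
    have h4 : MeasurePreserving (Prod.map (MeasurableEquiv.finTwoArrow (α := ℝ))
      (WithLp.toLp 2 : (Fin k → ℝ) → EuclideanSpace ℝ (Fin k))) :=
      (volume_preserving_finTwoArrow ℝ).prod (PiLp.volume_preserving_toLp (Fin k))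
    exact h4.comp (h3.comp (h2.comp h1))
  · simp [planeCoords, b.repr_apply_apply]
  · rw [← b.repr.norm_map u, EuclideanSpace.norm_sq_eq, EuclideanSpace.norm_sq_eq]
    simp [Fintype.sum_sum_type]

/-- The surface measure of a set is the dimension times the volume of the cone over it. In split
coordinates (a, w) the cone over a planar condition is a condition on a/‖w‖ inside the ball, which
`lintegral_ball_gnomonic` integrates. -/
lemma toSphere_map_planeCoords {k : ℕ} (hk : 0 < k)
    (b : OrthonormalBasis (Fin 2 ⊕ Fin k) ℝ E) :
    ∃ c : ℝ≥0∞, ((volume : Measure E).toSphere).map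
        (fun θ : Metric.sphere (0 : E) 1 => planeCoords (b (.inl 0)) (b (.inl 1)) (θ : E)) =
      c • (volume.withDensity fun ζ => ENNReal.ofReal (planeDensity (k + 2) ζ)).map gnomonic := by
  obtain ⟨Φ, hΦ, hΦ1, hΦ2⟩ := exists_measurePreserving_split b
  set e₁ := b (.inl 0)
  set e₂ := b (.inl 1)
  have hT : Measurable (fun θ : Metric.sphere (0 : E) 1 => planeCoords e₁ e₂ (θ : E)) :=
    ((continuous_planeCoords e₁ e₂).comp continuous_subtype_val).measurable
  have : Nonempty (Fin k) := ⟨⟨0, hk⟩⟩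
  refine ⟨Module.finrank ℝ E * ∫⁻ w : EuclideanSpace ℝ (Fin k),
    {w : EuclideanSpace ℝ (Fin k) | ‖w‖ < 1}.indicator
      (fun w => ENNReal.ofReal (‖w‖ ^ 2)) w, ?_⟩
  ext S hS
  rw [Measure.map_apply hT hS, Measure.toSphere_apply' _ (hT hS), Measure.smul_apply, smul_eq_mul,
    Measure.map_apply continuous_gnomonic.measurable hS,
    withDensity_apply _ (continuous_gnomonic.measurable hS), mul_assoc]
  congr 1
  have hpre : MeasurableSet (gnomonic ⁻¹' S) := continuous_gnomonic.measurable hS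
  have key := lintegral_ball_gnomonic (W := EuclideanSpace ℝ (Fin k))
    (f := (gnomonic ⁻¹' S).indicator 1) (measurable_one.indicator hpre)
  rw [finrank_euclideanSpace_fin] at key
  have hr : ∫⁻ ζ in gnomonic ⁻¹' S, ENNReal.ofReal (planeDensity (k + 2) ζ) =
      ∫⁻ ζ : ℝ × ℝ, (gnomonic ⁻¹' S).indicator 1 ζ *
        ENNReal.ofReal (planeDensity (k + 2) ζ) := by
    rw [← lintegral_indicator hpre]
    refine lintegral_congr fun ζ => ?_
    by_cases h : ζ ∈ gnomonic ⁻¹' S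
    · rw [Set.indicator_of_mem h, Set.indicator_of_mem h, Pi.one_apply, one_mul]
    · rw [Set.indicator_of_notMem h, Set.indicator_of_notMem h, zero_mul]
  rw [hr, ← key]
  set A : Set ((ℝ × ℝ) × EuclideanSpace ℝ (Fin k)) :=
    {p | p.1.1 ^ 2 + p.1.2 ^ 2 + ‖p.2‖ ^ 2 < 1 ∧ ‖p.2‖⁻¹ • p.1 ∈ gnomonic ⁻¹' S} with hA
  have hball : MeasurableSet {p : (ℝ × ℝ) × EuclideanSpace ℝ (Fin k) |
      p.1.1 ^ 2 + p.1.2 ^ 2 + ‖p.2‖ ^ 2 < 1} := measurableSet_lt (by fun_prop) (by fun_prop)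
  have hAm : MeasurableSet A := hball.inter
      ((by fun_prop : Measurable fun p : (ℝ × ℝ) × EuclideanSpace ℝ (Fin k) =>
        ‖p.2‖⁻¹ • p.1) hpre)
  have hind : ∀ p : (ℝ × ℝ) × EuclideanSpace ℝ (Fin k),
      {p : (ℝ × ℝ) × EuclideanSpace ℝ (Fin k) |
        p.1.1 ^ 2 + p.1.2 ^ 2 + ‖p.2‖ ^ 2 < 1}.indicator
        (fun p => (gnomonic ⁻¹' S).indicator (1 : ℝ × ℝ → ℝ≥0∞) (‖p.2‖⁻¹ • p.1)) p =
      A.indicator 1 p := by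
    intro p
    classical
    rw [hA, Set.indicator_apply, Set.indicator_apply, Set.indicator_apply]
    simp only [Set.mem_ofPred_eq]
    by_cases h1 : p.1.1 ^ 2 + p.1.2 ^ 2 + ‖p.2‖ ^ 2 < 1
    · simp only [h1, if_true, true_and]; rfl
    · simp only [h1, if_false, false_and]
  simp_rw [hind]
  rw [lintegral_indicator_one hAm, ← hΦ.measure_preimage hAm.nullMeasurableSet,
    Ioo_smul_image_sphere]
  -- The chart misses the vectors lying in the plane; they are null because `k > 0`.
  have hnull : ∀ᵐ u : E, (Φ u).2 ≠ 0 := by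
    have h0 : ∀ᵐ p : (ℝ × ℝ) × EuclideanSpace ℝ (Fin k), p.2 ≠ 0 := by
      have : ∀ᵐ w : EuclideanSpace ℝ (Fin k), w ≠ 0 := by
        rw [ae_iff]; simp
      exact Measure.quasiMeasurePreserving_snd.ae this
    exact hΦ.quasiMeasurePreserving.ae h0
  refine measure_congr ?_
  filter_upwards [hnull] with u hu
  refine propext ?_
  have hw : 0 < ‖(Φ u).2‖ := norm_pos_iff.2 hu
  have hun : 0 < ‖u‖ := by
    have := hΦ2 u
    rw [norm_pos_iff]
    rintro rfl
    rw [norm_zero] at this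
    nlinarith [sq_nonneg (Φ (0 : E)).1.1, sq_nonneg (Φ (0 : E)).1.2, pow_pos hw 2]
  have hg : gnomonic (‖(Φ u).2‖⁻¹ • (Φ u).1) = planeCoords e₁ e₂ (‖u‖⁻¹ • u) := by
    rw [gnomonic_div _ hw hun (hΦ2 u), hΦ1, planeCoords_smul]
  change (‖u‖ < 1 ∧ u ≠ 0 ∧ ‖u‖⁻¹ • u ∈ (Subtype.val '' _ : Set E)) ↔
    ((Φ u).1.1 ^ 2 + (Φ u).1.2 ^ 2 + ‖(Φ u).2‖ ^ 2 < 1 ∧ gnomonic (‖(Φ u).2‖⁻¹ • (Φ u).1) ∈ S)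
  rw [← hΦ2 u, hg, pow_lt_one_iff_of_nonneg hun.le two_ne_zero]
  refine and_congr_right fun _ => ?_
  constructor
  · rintro ⟨_, θ, hθ, h⟩
    rw [← h]; exact hθ
  · intro h
    exact ⟨norm_pos_iff.1 hun, ⟨‖u‖⁻¹ • u, by simp [norm_smul, hun.ne']⟩, h, rfl⟩

end Sphere

end MeanFieldSpherical

/-! ### Reduction of the magnetization to two order parameters -/

namespace MeanFieldSpherical

open scoped ENNReal

/-- Writing w as a multiple of the second basis vector also covers w = 0, which occurs when the
field is constant on the volume; the second vector is then arbitrary. -/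
lemma exists_orthonormalBasis_of_inner_eq_zero {k : ℕ} {E : Type*} [NormedAddCommGroup E]
    [InnerProductSpace ℝ E] [FiniteDimensional ℝ E] (hE : Module.finrank ℝ E = k + 2) (e w : E)
    (he : ‖e‖ = 1) (hew : inner ℝ e w = 0) :
    ∃ b : OrthonormalBasis (Fin 2 ⊕ Fin k) ℝ E, b (.inl 0) = e ∧ w = ‖w‖ • b (.inl 1) := by
  have hcard : Module.finrank ℝ E = Fintype.card (Fin 2 ⊕ Fin k) := by
    rw [hE, Fintype.card_sum, Fintype.card_fin, Fintype.card_fin, add_comm]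
  by_cases hw : w = 0
  · have hv : Orthonormal ℝ (({.inl 0} : Set (Fin 2 ⊕ Fin k)).domRestrict fun _ => e) := by
      refine ⟨fun i => he, fun i j hij => ?_⟩
      exact absurd (Subtype.ext (i.2.trans j.2.symm)) hij
    obtain ⟨b, hb⟩ := hv.exists_orthonormalBasis_extension_of_card_eq hcard
    exact ⟨b, hb _ rfl, by simp [hw]⟩
  · have hw' : ‖w‖ ≠ 0 := norm_ne_zero_iff.2 hw
    have hv : Orthonormal ℝ (({.inl 0, .inl 1} : Set (Fin 2 ⊕ Fin k)).domRestrict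
        (Sum.elim ![e, ‖w‖⁻¹ • w] fun _ => 0)) := by
      constructor
      · rintro ⟨i, rfl | rfl⟩
        · simpa using he
        · simp [norm_smul, hw']
      · rintro ⟨i, rfl | rfl⟩ ⟨j, rfl | rfl⟩ hij
        · exact absurd rfl hij
        · simp [inner_smul_right, hew]
        · simp [inner_smul_left, real_inner_comm, hew]
        · exact absurd rfl hij
    obtain ⟨b, hb⟩ := hv.exists_orthonormalBasis_extension_of_card_eq hcard
    refine ⟨b, by simpa using hb (.inl 0) (by simp), ?_⟩
    rw [hb (.inl 1) (by simp)]
    simp [smul_smul, hw']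

/-- The mean of the first `n` terms. -/
noncomputable def sampleMean (n : ℕ) (h : ℕ → ℝ) : ℝ := (∑ i ∈ Finset.range n, h i) / n

/-- The standard deviation of the first `n` terms. -/
noncomputable def sampleStd (n : ℕ) (h : ℕ → ℝ) : ℝ :=
  √((∑ i ∈ Finset.range n, h i ^ 2) / n - sampleMean n h ^ 2)

/-- The energy density in terms of the two order parameters. -/
noncomputable def energy (β J : ℝ) (p z : ℝ × ℝ) : ℝ :=
  β * J / 2 * z.1 ^ 2 + β * (p.1 * z.1 + p.2 * z.2)

/-- Weight of the Gibbs state in the gnomonic chart. -/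
noncomputable def planeWeight (n : ℕ) (β J : ℝ) (p ζ : ℝ × ℝ) : ℝ :=
  Real.exp (n * energy β J p (gnomonic ζ)) * planeDensity n ζ

/-- The magnetization density as a function of the sample mean and standard deviation. -/
noncomputable def planeMagnetization (n : ℕ) (β J : ℝ) (p : ℝ × ℝ) : ℝ :=
  (∫ ζ, (gnomonic ζ).1 * planeWeight n β J p ζ) / ∫ ζ, planeWeight n β J p ζ

/-- The basis starts with the normalized all-ones vector and the direction of the field minus its
sample mean. These are orthogonal, and the centred field divided by √n has norm equal to the sample
standard deviation. -/
lemma exists_basis_field {k : ℕ} (h : ℕ → ℝ) :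
    ∃ b : OrthonormalBasis (Fin 2 ⊕ Fin k) ℝ (EuclideanSpace ℝ (Fin (k + 2))),
      (∀ θ : EuclideanSpace ℝ (Fin (k + 2)),
        ∑ i, θ i = √((k + 2 : ℕ) : ℝ) * inner ℝ (b (.inl 0)) θ) ∧
      ∀ θ : EuclideanSpace ℝ (Fin (k + 2)), ∑ i : Fin (k + 2), h i * θ i =
        √((k + 2 : ℕ) : ℝ) * (sampleMean (k + 2) h * inner ℝ (b (.inl 0)) θ +
          sampleStd (k + 2) h * inner ℝ (b (.inl 1)) θ) := by
  set n := k + 2 with hn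
  have hn0 : (0 : ℝ) < n := by positivity
  set s := √(n : ℝ) with hs
  have hs0 : 0 < s := Real.sqrt_pos.2 hn0
  have hs2 : s ^ 2 = n := Real.sq_sqrt hn0.le
  set one : EuclideanSpace ℝ (Fin n) := WithLp.toLp 2 fun _ => 1
  set H : EuclideanSpace ℝ (Fin n) := WithLp.toLp 2 fun i => h i
  set a := sampleMean n h with ha
  have hone : ∀ θ : EuclideanSpace ℝ (Fin n), inner ℝ one θ = ∑ i, θ i := by
    intro θ; simp [one, PiLp.inner_apply]
  have hH : ∀ θ : EuclideanSpace ℝ (Fin n), inner ℝ H θ = ∑ i : Fin n, h i * θ i := by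
    intro θ; simp [H, PiLp.inner_apply, mul_comm]
  have hsum : ∑ i : Fin n, h i = n * a := by
    rw [ha, sampleMean, Finset.sum_range]; field_simp
  have honeH : inner ℝ one H = n * a := by rw [hone, ← hsum]
  have honeone : inner ℝ one one = (n : ℝ) := by rw [hone]; simp [one]
  have hHH : inner ℝ H H = ∑ i ∈ Finset.range n, h i ^ 2 := by
    rw [hH, Finset.sum_range]; simp [H, sq]
  have he : ‖s⁻¹ • one‖ = 1 := by
    rw [← sq_eq_sq₀ (norm_nonneg _) zero_le_one, ← real_inner_self_eq_norm_sq, inner_smul_left,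
      inner_smul_right, honeone, ← hs2]
    simp; field_simp
  have hew : inner ℝ (s⁻¹ • one) (s⁻¹ • (H - a • one)) = 0 := by
    rw [inner_smul_left, inner_smul_right, inner_sub_right, inner_smul_right, honeH, honeone]
    ring
  obtain ⟨b, hb0, hb1⟩ := exists_orthonormalBasis_of_inner_eq_zero
    (finrank_euclideanSpace_fin (𝕜 := ℝ) (n := n)) _ _ he hew
  have hw : ‖s⁻¹ • (H - a • one)‖ = sampleStd n h := by
    have h1 : ‖s⁻¹ • (H - a • one)‖ ^ 2 =
        (∑ i ∈ Finset.range n, h i ^ 2) / n - sampleMean n h ^ 2 := by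
      rw [← real_inner_self_eq_norm_sq, inner_smul_left, inner_smul_right, inner_sub_left,
        inner_sub_right, inner_sub_right, inner_smul_left, inner_smul_left, inner_smul_right,
        inner_smul_right, hHH, real_inner_comm, honeH, honeone, ← ha, ← hs2]
      simp only [conj_trivial]
      field_simp
      ring
    rw [sampleStd, ← h1, Real.sqrt_sq (norm_nonneg _)]
  rw [hw] at hb1
  refine ⟨b, fun θ => ?_, fun θ => ?_⟩
  · rw [hb0, inner_smul_left, hone]
    simp only [conj_trivial]
    field_simp
  · have h2 : H = s • (a • b (.inl 0) + sampleStd n h • b (.inl 1)) := by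
      rw [← hb1, hb0, smul_add, smul_smul s s⁻¹, mul_inv_cancel₀ hs0.ne', one_smul, smul_comm s a,
        smul_smul s s⁻¹, mul_inv_cancel₀ hs0.ne', one_smul]
      abel
    rw [← hH, h2, inner_smul_left, inner_add_left, inner_smul_left, inner_smul_left]
    simp

lemma measurable_extendByZero (n : ℕ) : Measurable (extendByZero n) := by
  refine measurable_pi_lambda _ fun i => ?_
  unfold extendByZero
  split_ifs <;> fun_prop

lemma continuous_hamiltonian (n : ℕ) (J : ℝ) (h : ℕ → ℝ) : Continuous (hamiltonian n J h) := by
  unfold hamiltonian; fun_prop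

lemma magnetization_extendByZero (n : ℕ) (φ : EuclideanSpace ℝ (Fin n)) :
    magnetization n (extendByZero n φ) = ∑ i, φ i := by
  rw [magnetization, Finset.sum_range]
  simp [extendByZero]

lemma magnetizationDensity_eq (n : ℕ) (β J : ℝ) (h : ℕ → ℝ) :
    magnetizationDensity n β J h =
      (∫ φ, ((∑ i, φ i) / n) * Real.exp (-β * hamiltonian n J h φ) ∂(sphereUniform n)) /
        ∫ φ, Real.exp (-β * hamiltonian n J h φ) ∂(sphereUniform n) := by
  rw [magnetizationDensity, gibbsState, integral_map (measurable_extendByZero n).aemeasurable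
    (by unfold magnetization; fun_prop), integral_tilted, ← integral_div]
  refine integral_congr_ae (ae_of_all _ fun φ => ?_)
  simp only [magnetization_extendByZero, smul_eq_mul]
  ring

/-- The constant is chosen before F and G, so it is common to the numerator and the denominator of a
Gibbs average and cancels there. -/
lemma integral_sphereUniform_planeCoords {k : ℕ} (hk : 0 < k)
    (b : OrthonormalBasis (Fin 2 ⊕ Fin k) ℝ (EuclideanSpace ℝ (Fin (k + 2)))) :
    ∃ c : ℝ, c ≠ 0 ∧ ∀ (F : EuclideanSpace ℝ (Fin (k + 2)) → ℝ) (G : ℝ × ℝ → ℝ), Continuous F →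
      Continuous G →
      (∀ θ, F (√((k + 2 : ℕ) : ℝ) • θ) = G (planeCoords (b (.inl 0)) (b (.inl 1)) θ)) →
      ∫ φ, F φ ∂(sphereUniform (k + 2)) = c * ∫ ζ, G (gnomonic ζ) * planeDensity (k + 2) ζ := by
  obtain ⟨c, hc⟩ := toSphere_map_planeCoords hk b
  set V := (volume : Measure (EuclideanSpace ℝ (Fin (k + 2)))).toSphere with hV
  have hT : Measurable (fun θ : Metric.sphere (0 : EuclideanSpace ℝ (Fin (k + 2))) 1 =>
      planeCoords (b (.inl 0)) (b (.inl 1)) (θ : EuclideanSpace ℝ (Fin (k + 2)))) :=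
    ((continuous_planeCoords _ _).comp continuous_subtype_val).measurable
  have hu : V Set.univ = c * ∫⁻ ζ, ENNReal.ofReal (planeDensity (k + 2) ζ) := by
    have := congrArg (fun ν => ν Set.univ) hc
    simpa [Measure.map_apply hT MeasurableSet.univ, continuous_gnomonic.measurable,
      Measure.map_apply] using this
  have hV0 : V Set.univ ≠ 0 := by
    rw [Ne, Measure.measure_univ_eq_zero]; exact Measure.toSphere_ne_zero _
  have hVt : V Set.univ ≠ ∞ := measure_ne_top _ _
  have hI0 : ∫⁻ ζ, ENNReal.ofReal (planeDensity (k + 2) ζ) ≠ 0 := by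
    intro h0; rw [h0, mul_zero] at hu; exact hV0 hu
  have hc0 : c ≠ 0 := by
    rintro rfl; rw [zero_mul] at hu; exact hV0 hu
  have hct : c ≠ ∞ := by
    rintro rfl; rw [ENNReal.top_mul hI0] at hu; exact hVt hu
  refine ⟨((V Set.univ)⁻¹).toReal * c.toReal, ?_, fun F G hF hG hFG => ?_⟩
  · exact mul_ne_zero (ENNReal.toReal_ne_zero.2 ⟨ENNReal.inv_ne_zero.2 hVt, ENNReal.inv_ne_top.2 hV0⟩)
      (ENNReal.toReal_ne_zero.2 ⟨hc0, hct⟩)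
  rw [sphereUniform, integral_map (by fun_prop) hF.aestronglyMeasurable, integral_smul_measure]
  simp_rw [hFG]
  rw [← integral_map (f := G) hT.aemeasurable hG.aestronglyMeasurable, hc, integral_smul_measure,
    integral_map continuous_gnomonic.aemeasurable hG.aestronglyMeasurable,
    integral_withDensity_eq_integral_toReal_smul
      (continuous_planeDensity _).measurable.ennreal_ofReal (by simp)]
  simp_rw [ENNReal.toReal_ofReal (planeDensity_pos _ _).le, smul_eq_mul]
  rw [mul_assoc]
  congr 3
  ext ζ
  ring

/-- The bound n ≥ 3 leaves at least one dimension orthogonal to the plane of the two order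
parameters. -/
theorem magnetizationDensity_eq_planeMagnetization {n : ℕ} (hn : 3 ≤ n) (β J : ℝ) (h : ℕ → ℝ) :
    magnetizationDensity n β J h = planeMagnetization n β J (sampleMean n h, sampleStd n h) := by
  obtain ⟨k, rfl⟩ : ∃ k, n = k + 2 := ⟨n - 2, by omega⟩
  obtain ⟨b, hb1, hb2⟩ := exists_basis_field (k := k) h
  obtain ⟨c, hc0, hc⟩ := integral_sphereUniform_planeCoords (by omega) b
  set s := √((k + 2 : ℕ) : ℝ) with hs
  have hn0 : (0 : ℝ) < (k + 2 : ℕ) := by positivity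
  have hs2 : s ^ 2 = (k + 2 : ℕ) := Real.sq_sqrt hn0.le
  set p : ℝ × ℝ := (sampleMean (k + 2) h, sampleStd (k + 2) h)
  have hE : ∀ θ, -β * hamiltonian (k + 2) J h (s • θ) =
      (k + 2 : ℕ) * energy β J p (planeCoords (b (.inl 0)) (b (.inl 1)) θ) := by
    intro θ
    have h1 : ∑ i : Fin (k + 2), (s • θ) i = (k + 2 : ℕ) * inner ℝ (b (.inl 0)) θ := by
      simp only [PiLp.smul_apply, smul_eq_mul]
      rw [← Finset.mul_sum, hb1, ← hs2]; ring
    have h2 : ∑ i : Fin (k + 2), h i * (s • θ) i = (k + 2 : ℕ) * (p.1 * inner ℝ (b (.inl 0)) θ +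
        p.2 * inner ℝ (b (.inl 1)) θ) := by
      have : ∀ i : Fin (k + 2), h i * (s • θ) i = s * (h i * θ i) := by
        intro i; simp only [PiLp.smul_apply, smul_eq_mul]; ring
      simp_rw [this]
      rw [← Finset.mul_sum, hb2, ← hs2]; ring
    rw [hamiltonian, h2, ← Finset.sum_mul_sum, h1, energy, planeCoords]
    field_simp
    ring
  have hM : ∀ θ, (∑ i, (s • θ) i) / (k + 2 : ℕ) = (planeCoords (b (.inl 0)) (b (.inl 1)) θ).1 := by
    intro θ
    simp only [PiLp.smul_apply, smul_eq_mul]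
    rw [← Finset.mul_sum, hb1, ← mul_assoc, ← sq, hs2, planeCoords]
    field_simp
  have hcont : Continuous fun z => Real.exp ((k + 2 : ℕ) * energy β J p z) := by
    unfold energy; fun_prop
  have hH := continuous_hamiltonian (k + 2) J h
  rw [magnetizationDensity_eq, hc _ (fun z => z.1 * Real.exp ((k + 2 : ℕ) * energy β J p z)) (by fun_prop)
      (by fun_prop) (fun θ => by rw [hM, hE]),
    hc _ (fun z => Real.exp ((k + 2 : ℕ) * energy β J p z)) (by fun_prop) hcont (fun θ => by rw [hE]),
    mul_div_mul_left _ _ hc0, planeMagnetization]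
  simp only [planeWeight, mul_assoc]

end MeanFieldSpherical

/-! ### The tilting function in the chart: growth and integrability -/

namespace MeanFieldSpherical

lemma gnomonic_mem_unitDisc (ζ : ℝ × ℝ) : gnomonic ζ ∈ unitDisc := by
  have h := one_add_sq_pos ζ
  change (ζ.1 / _) ^ 2 + (ζ.2 / _) ^ 2 < 1
  rw [div_pow, div_pow, Real.sq_sqrt h.le, ← add_div, div_lt_one h]
  linarith

lemma exists_gnomonic_eq {z : ℝ × ℝ} (hz : z ∈ unitDisc) : ∃ ζ, gnomonic ζ = z := by
  have h : 0 < 1 - (z.1 ^ 2 + z.2 ^ 2) := by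
    have : z.1 ^ 2 + z.2 ^ 2 < 1 := hz
    linarith
  have hs := Real.sqrt_pos.2 h
  refine ⟨(√(1 - (z.1 ^ 2 + z.2 ^ 2)))⁻¹ • z, ?_⟩
  rw [gnomonic_div z hs one_pos (by rw [Real.sq_sqrt h.le]; ring), inv_one, one_smul]

lemma abs_le_one_of_mem_unitDisc {z : ℝ × ℝ} (hz : z ∈ unitDisc) : |z.1| ≤ 1 ∧ |z.2| ≤ 1 := by
  have : z.1 ^ 2 + z.2 ^ 2 < 1 := hz
  constructor
  · rw [← sq_le_one_iff_abs_le_one]; nlinarith [sq_nonneg z.2]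
  · rw [← sq_le_one_iff_abs_le_one]; nlinarith [sq_nonneg z.1]

/-- The exponential tilting function in the gnomonic chart. -/
noncomputable def planeTilting (β J : ℝ) (p ζ : ℝ × ℝ) : ℝ := tilting β J p (gnomonic ζ)

lemma planeTilting_eq (β J : ℝ) (p ζ : ℝ × ℝ) :
    planeTilting β J p ζ =
      energy β J p (gnomonic ζ) - 1 / 2 * Real.log (1 + (ζ.1 ^ 2 + ζ.2 ^ 2)) := by
  have h := one_add_sq_pos ζ
  have h1 : 1 - ((gnomonic ζ).1 ^ 2 + (gnomonic ζ).2 ^ 2) = (1 + (ζ.1 ^ 2 + ζ.2 ^ 2))⁻¹ := by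
    change 1 - ((ζ.1 / _) ^ 2 + (ζ.2 / _) ^ 2) = _
    rw [div_pow, div_pow, Real.sq_sqrt h.le]
    field_simp
    ring
  rw [planeTilting, tilting, energy, h1, Real.log_inv]
  ring

lemma continuous_energy (β J : ℝ) (p : ℝ × ℝ) : Continuous (energy β J p) := by
  unfold energy; fun_prop

lemma continuous_planeTilting (β J : ℝ) (p : ℝ × ℝ) : Continuous (planeTilting β J p) := by
  rw [funext (planeTilting_eq β J p)]
  refine ((continuous_energy β J p).comp continuous_gnomonic).sub (continuous_const.mul ?_)
  exact Continuous.log (by fun_prop) fun ζ => (one_add_sq_pos ζ).ne'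

/-- This identity is the reason for the gnomonic chart: the projected measure on the disc would
leave a power of 1-|z|² outside the exponential. -/
lemma planeWeight_eq_exp (n : ℕ) (β J : ℝ) (p ζ : ℝ × ℝ) :
    planeWeight n β J p ζ = Real.exp (n * planeTilting β J p ζ) := by
  have h := one_add_sq_pos ζ
  have hs : √(1 + (ζ.1 ^ 2 + ζ.2 ^ 2)) = Real.exp (1 / 2 * Real.log (1 + (ζ.1 ^ 2 + ζ.2 ^ 2))) := by
    rw [Real.sqrt_eq_rpow, Real.rpow_def_of_pos h, mul_comm]
  rw [planeWeight, planeDensity, planeTilting_eq, mul_sub, Real.exp_sub, div_eq_mul_inv, inv_pow,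
    hs, ← Real.exp_nat_mul]

lemma abs_energy_sub_le {β J : ℝ} (hβ : 0 < β) (p m : ℝ × ℝ) {z : ℝ × ℝ} (hz : z ∈ unitDisc) :
    |energy β J p z - energy β J m z| ≤ β * (|p.1 - m.1| + |p.2 - m.2|) := by
  obtain ⟨h1, h2⟩ := abs_le_one_of_mem_unitDisc hz
  have : energy β J p z - energy β J m z = β * ((p.1 - m.1) * z.1 + (p.2 - m.2) * z.2) := by
    rw [energy, energy]; ring
  rw [this, abs_mul, abs_of_pos hβ]
  refine mul_le_mul_of_nonneg_left ((abs_add_le _ _).trans ?_) hβ.le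
  rw [abs_mul, abs_mul]
  exact add_le_add (mul_le_of_le_one_right (abs_nonneg _) h1)
    (mul_le_of_le_one_right (abs_nonneg _) h2)

/-- The logarithmic term does not involve the field and cancels; the energy is linear in the field
parameters with coefficients bounded on the disc. The estimate is thus uniform in ζ. -/
lemma abs_planeTilting_sub_le {β J : ℝ} (hβ : 0 < β) (p m ζ : ℝ × ℝ) :
    |planeTilting β J p ζ - planeTilting β J m ζ| ≤ β * (|p.1 - m.1| + |p.2 - m.2|) := by
  rw [planeTilting_eq, planeTilting_eq, sub_sub_sub_cancel_right]
  exact abs_energy_sub_le hβ p m (gnomonic_mem_unitDisc ζ)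

lemma energy_le {β J : ℝ} (hβ : 0 < β) (hJ : 0 < J) (p : ℝ × ℝ) {z : ℝ × ℝ} (hz : z ∈ unitDisc) :
    energy β J p z ≤ β * J / 2 + β * (|p.1| + |p.2|) := by
  have h0 := abs_energy_sub_le (J := J) hβ p 0 hz
  have h1 : energy β J 0 z ≤ β * J / 2 := by
    have : z.1 ^ 2 ≤ 1 := (sq_le_one_iff_abs_le_one _).2 (abs_le_one_of_mem_unitDisc hz).1
    simp only [energy, Prod.fst_zero, Prod.snd_zero, zero_mul, add_zero, mul_zero]
    exact mul_le_of_le_one_right (by positivity) this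
  simp only [Prod.fst_zero, Prod.snd_zero, sub_zero] at h0
  linarith [le_abs_self (energy β J p z - energy β J 0 z)]

lemma tendsto_planeTilting_cocompact {β J : ℝ} (hβ : 0 < β) (hJ : 0 < J) (p : ℝ × ℝ) :
    Tendsto (planeTilting β J p) (cocompact (ℝ × ℝ)) atBot := by
  have h1 : Tendsto (fun ζ : ℝ × ℝ => 1 + (ζ.1 ^ 2 + ζ.2 ^ 2)) (cocompact (ℝ × ℝ)) atTop := by
    refine tendsto_atTop_mono (fun ζ => ?_) (tendsto_norm_cocompact_atTop (E := ℝ × ℝ))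
    rw [Prod.norm_def, Real.norm_eq_abs, Real.norm_eq_abs]
    refine max_le ?_ ?_
    · nlinarith [sq_abs ζ.1, sq_nonneg (|ζ.1| - 1), sq_nonneg ζ.2, abs_nonneg ζ.1]
    · nlinarith [sq_abs ζ.2, sq_nonneg (|ζ.2| - 1), sq_nonneg ζ.1, abs_nonneg ζ.2]
  have h2 := (Real.tendsto_log_atTop.comp h1).const_mul_atTop (by norm_num : (0 : ℝ) < 1 / 2)
  have h3 := tendsto_atBot_add_const_left _ (β * J / 2 + β * (|p.1| + |p.2|))
    (tendsto_neg_atTop_atBot.comp h2)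
  refine tendsto_atBot_mono (fun ζ => ?_) h3
  rw [planeTilting_eq, sub_eq_add_neg]
  exact add_le_add_left (energy_le hβ hJ p (gnomonic_mem_unitDisc ζ)) _

/-- The exponent 3 is the first integer above the dimension 2 of the plane; larger n give smaller
densities. -/
lemma integrable_planeDensity {n : ℕ} (hn : 3 ≤ n) : Integrable (planeDensity n) := by
  have h := integrable_rpow_neg_one_add_norm_sq (E := ℝ × ℝ) (μ := volume) (r := 3) (by simp; norm_num)
  refine h.mono' (continuous_planeDensity n).aestronglyMeasurable (ae_of_all _ fun ζ => ?_)
  have h0 := one_add_sq_pos ζ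
  have h1 : 1 ≤ √(1 + (ζ.1 ^ 2 + ζ.2 ^ 2)) := Real.one_le_sqrt.2 (by nlinarith [sq_nonneg ζ.1, sq_nonneg ζ.2])
  rw [Real.norm_of_nonneg (planeDensity_pos n ζ).le]
  calc planeDensity n ζ ≤ planeDensity 3 ζ :=
        pow_le_pow_of_le_one (by positivity) (inv_le_one_of_one_le₀ h1) hn
    _ = (1 + (ζ.1 ^ 2 + ζ.2 ^ 2)) ^ (-3 / 2 : ℝ) := by
        rw [planeDensity, Real.sqrt_eq_rpow, ← Real.rpow_neg h0.le, ← Real.rpow_natCast,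
          ← Real.rpow_mul h0.le]
        norm_num
    _ ≤ (1 + ‖ζ‖ ^ 2) ^ (-3 / 2 : ℝ) := by
        refine Real.rpow_le_rpow_of_nonpos (by positivity) ?_ (by norm_num)
        rw [Prod.norm_def, Real.norm_eq_abs, Real.norm_eq_abs]
        rcases max_choice |ζ.1| |ζ.2| with h | h <;> rw [h, sq_abs] <;>
          nlinarith [sq_nonneg ζ.1, sq_nonneg ζ.2]

lemma continuous_planeWeight (n : ℕ) (β J : ℝ) (p : ℝ × ℝ) : Continuous (planeWeight n β J p) := by
  rw [funext (planeWeight_eq_exp n β J p)]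
  exact Real.continuous_exp.comp (continuous_const.mul (continuous_planeTilting β J p))

lemma planeWeight_pos (n : ℕ) (β J : ℝ) (p ζ : ℝ × ℝ) : 0 < planeWeight n β J p ζ := by
  rw [planeWeight_eq_exp]; exact Real.exp_pos _

lemma integrable_planeWeight {n : ℕ} (hn : 3 ≤ n) {β J : ℝ} (hβ : 0 < β) (hJ : 0 < J)
    (p : ℝ × ℝ) : Integrable (planeWeight n β J p) := by
  refine ((integrable_planeDensity hn).const_mul
    (Real.exp (n * (β * J / 2 + β * (|p.1| + |p.2|))))).mono'
    (continuous_planeWeight n β J p).aestronglyMeasurable (ae_of_all _ fun ζ => ?_)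
  rw [Real.norm_of_nonneg (planeWeight_pos _ _ _ _ _).le, planeWeight]
  refine mul_le_mul_of_nonneg_right (Real.exp_le_exp.2 ?_) (planeDensity_pos n ζ).le
  exact mul_le_mul_of_nonneg_left (energy_le hβ hJ p (gnomonic_mem_unitDisc ζ)) n.cast_nonneg

lemma integral_planeWeight_pos {n : ℕ} (hn : 3 ≤ n) {β J : ℝ} (hβ : 0 < β) (hJ : 0 < J)
    (p : ℝ × ℝ) : 0 < ∫ ζ, planeWeight n β J p ζ := by
  have h := integrable_planeWeight hn hβ hJ p
  rw [funext (planeWeight_eq_exp n β J p)] at h ⊢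
  exact integral_exp_pos h

end MeanFieldSpherical

/-! ### Laplace asymptotics of the magnetization -/

namespace MeanFieldSpherical

section Laplace

variable {β J : ℝ}

lemma exists_forall_planeTilting_le (hβ : 0 < β) (hJ : 0 < J) (m : ℝ × ℝ) :
    ∃ ζ₀, ∀ ζ, planeTilting β J m ζ ≤ planeTilting β J m ζ₀ :=
  (continuous_planeTilting β J m).exists_forall_ge (tendsto_planeTilting_cocompact hβ hJ m)

/-- Since the tilting function tends to -∞ at infinity, it attains its supremum on a nonempty closed
set. The factor 4 leaves room for the perturbation of the parameters. -/
lemma exists_gap_planeTilting (hβ : 0 < β) (hJ : 0 < J) (m : ℝ × ℝ) {K : Set (ℝ × ℝ)}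
    (hK : IsClosed K) {ζ₀ : ℝ × ℝ} (hζ₀ : ∀ ζ ∈ K, planeTilting β J m ζ < planeTilting β J m ζ₀) :
    ∃ η > 0, ∀ ζ ∈ K, planeTilting β J m ζ ≤ planeTilting β J m ζ₀ - 4 * η := by
  rcases K.eq_empty_or_nonempty with rfl | ⟨ζ₁, h₁⟩
  · exact ⟨1, one_pos, by simp⟩
  have hc : ∀ᶠ ζ in cocompact (ℝ × ℝ) ⊓ 𝓟 K, planeTilting β J m ζ ≤ planeTilting β J m ζ₁ :=
    ((tendsto_planeTilting_cocompact hβ hJ m).eventually (eventually_le_atBot _)).filter_mono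
      inf_le_left
  obtain ⟨ζ₂, h₂, hmax⟩ := (continuous_planeTilting β J m).continuousOn.exists_isMaxOn' hK h₁ hc
  refine ⟨(planeTilting β J m ζ₀ - planeTilting β J m ζ₂) / 4, by linarith [hζ₀ ζ₂ h₂], ?_⟩
  intro ζ hζ
  have := hmax hζ
  simp only [Set.mem_ofPred_eq] at this
  linarith

/-- Laplace principle: the Gibbs weights concentrate away from closed sets without maximizers. -/
lemma tendsto_setIntegral_planeWeight_div (hβ : 0 < β) (hJ : 0 < J) {m : ℝ × ℝ}
    {K : Set (ℝ × ℝ)} (hK : IsClosed K)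
    (hKm : ∀ ζ ∈ K, ∃ ζ', planeTilting β J m ζ < planeTilting β J m ζ')
    {ι : Type*} {l : Filter ι} {N : ι → ℕ} {p : ι → ℝ × ℝ} (hN : Tendsto N l atTop)
    (hp : Tendsto p l (𝓝 m)) :
    Tendsto (fun i => (∫ ζ in K, planeWeight (N i) β J (p i) ζ) /
      ∫ ζ, planeWeight (N i) β J (p i) ζ) l (𝓝 0) := by
  obtain ⟨ζ₀, hζ₀⟩ := exists_forall_planeTilting_le hβ hJ m
  obtain ⟨η, hη, hgap⟩ := exists_gap_planeTilting hβ hJ m hK (ζ₀ := ζ₀) fun ζ hζ => by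
    obtain ⟨ζ', h'⟩ := hKm ζ hζ
    exact h'.trans_le (hζ₀ ζ')
  set L := planeTilting β J m ζ₀ with hL
  -- With parameters η-close to the limit, the exponent is at least L - 2η on V and at most L - 3η
  -- on K, so the ratio decays like exp(-Nη). The ball only serves to give V finite volume.
  set V : Set (ℝ × ℝ) := {ζ | L - η < planeTilting β J m ζ} ∩ Metric.ball ζ₀ 1 with hV
  have hVo : IsOpen V :=
    (isOpen_lt continuous_const (continuous_planeTilting β J m)).inter Metric.isOpen_ball
  have hVne : V.Nonempty := ⟨ζ₀, by simpa [hL] using hη, Metric.mem_ball_self one_pos⟩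
  have hVfin : volume V ≠ ⊤ :=
    ((measure_mono Set.inter_subset_right).trans_lt measure_ball_lt_top).ne
  set v := volume.real V
  have hv : 0 < v := ENNReal.toReal_pos (hVo.measure_pos _ hVne).ne' hVfin
  set I := ∫ ζ, planeWeight 3 β J m ζ
  have hI : 0 < I := integral_planeWeight_pos le_rfl hβ hJ m
  set C := Real.exp (-3 * (L - 3 * η) + 3 * η) * I / v
  have hlim : Tendsto (fun i => C * Real.exp (-((N i : ℝ) * η))) l (𝓝 0) := by
    rw [← mul_zero C]
    refine Tendsto.const_mul C (Real.tendsto_exp_neg_atTop_nhds_zero.comp ?_)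
    exact (tendsto_natCast_atTop_atTop.comp hN).atTop_mul_const hη
  have hclose : ∀ᶠ i in l, β * (|(p i).1 - m.1| + |(p i).2 - m.2|) < η := by
    have h1 : Tendsto (fun i => β * (|(p i).1 - m.1| + |(p i).2 - m.2|)) l
        (𝓝 (β * (|m.1 - m.1| + |m.2 - m.2|))) :=
      ((((continuous_fst.tendsto m).comp hp).sub_const m.1).abs.add
        (((continuous_snd.tendsto m).comp hp).sub_const m.2).abs).const_mul β
    simp only [sub_self, abs_zero, add_zero, mul_zero] at h1
    exact h1.eventually (gt_mem_nhds hη)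
  refine squeeze_zero' ?_ ?_ hlim
  · exact Eventually.of_forall fun i => div_nonneg
      (integral_nonneg fun ζ => (planeWeight_pos _ _ _ _ _).le)
      (integral_nonneg fun ζ => (planeWeight_pos _ _ _ _ _).le)
  filter_upwards [hclose, hN.eventually_ge_atTop 3] with i hi hNi
  have hdiff := fun ζ => abs_le.1 ((abs_planeTilting_sub_le (J := J) hβ (p i) m ζ).trans hi.le)
  have hint := integrable_planeWeight hNi hβ hJ (p i)
  have hlow : v * Real.exp (N i * (L - 2 * η)) ≤ ∫ ζ, planeWeight (N i) β J (p i) ζ := by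
    calc v * Real.exp (N i * (L - 2 * η)) = ∫ _ in V, Real.exp (N i * (L - 2 * η)) := by
          rw [setIntegral_const, smul_eq_mul]
      _ ≤ ∫ ζ in V, planeWeight (N i) β J (p i) ζ := by
          refine setIntegral_mono_on (integrableOn_const hVfin) hint.integrableOn
            hVo.measurableSet fun ζ hζ => ?_
          rw [planeWeight_eq_exp]
          refine Real.exp_le_exp.2 (mul_le_mul_of_nonneg_left ?_ (Nat.cast_nonneg _))
          have h1 : L - η < planeTilting β J m ζ := hζ.1
          linarith [(hdiff ζ).1]
      _ ≤ ∫ ζ, planeWeight (N i) β J (p i) ζ :=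
          setIntegral_le_integral hint (ae_of_all _ fun ζ => (planeWeight_pos _ _ _ _ _).le)
  have hup : ∫ ζ in K, planeWeight (N i) β J (p i) ζ ≤
      Real.exp (N i * (L - 3 * η)) * (Real.exp (-3 * (L - 3 * η) + 3 * η) * I) := by
    have hint3 := integrable_planeWeight le_rfl hβ hJ m
    calc ∫ ζ in K, planeWeight (N i) β J (p i) ζ
        ≤ ∫ ζ in K, Real.exp (N i * (L - 3 * η)) *
            (Real.exp (-3 * (L - 3 * η) + 3 * η) * planeWeight 3 β J m ζ) := by
          refine setIntegral_mono_on hint.integrableOn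
            ((hint3.const_mul _).const_mul _).integrableOn hK.measurableSet fun ζ hζ => ?_
          rw [planeWeight_eq_exp, planeWeight_eq_exp, ← Real.exp_add, ← Real.exp_add]
          refine Real.exp_le_exp.2 ?_
          have h1 := hgap ζ hζ
          have h2 := (hdiff ζ).2
          have h3 : (3 : ℝ) ≤ N i := by exact_mod_cast hNi
          -- Three of the N factors are kept as an integrable reference weight, since K may have
          -- infinite volume; only the other N - 3 are bounded by their supremum.
          have h4 : ((N i : ℝ) - 3) * planeTilting β J (p i) ζ ≤ ((N i : ℝ) - 3) * (L - 3 * η) :=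
            mul_le_mul_of_nonneg_left (by linarith) (by linarith)
          push_cast
          linarith
      _ ≤ ∫ ζ, Real.exp (N i * (L - 3 * η)) *
            (Real.exp (-3 * (L - 3 * η) + 3 * η) * planeWeight 3 β J m ζ) :=
          setIntegral_le_integral ((hint3.const_mul _).const_mul _) (ae_of_all _ fun ζ =>
            (mul_pos (Real.exp_pos _) (mul_pos (Real.exp_pos _) (planeWeight_pos _ _ _ _ _))).le)
      _ = _ := by rw [integral_const_mul, integral_const_mul]
  rw [div_le_iff₀ (integral_planeWeight_pos hNi hβ hJ _)]
  refine hup.trans ?_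
  have hexp : Real.exp (N i * (L - 3 * η)) =
      Real.exp (-((N i : ℝ) * η)) * Real.exp (N i * (L - 2 * η)) := by
    rw [← Real.exp_add]; ring_nf
  calc Real.exp (N i * (L - 3 * η)) * (Real.exp (-3 * (L - 3 * η) + 3 * η) * I)
      = C * Real.exp (-((N i : ℝ) * η)) * (v * Real.exp (N i * (L - 2 * η))) := by
        rw [hexp]; simp only [C]; field_simp
    _ ≤ _ := mul_le_mul_of_nonneg_left hlow
        (mul_nonneg (div_nonneg (mul_nonneg (Real.exp_pos _).le hI.le) hv.le) (Real.exp_pos _).le)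

lemma tendsto_planeMagnetization_of_concentration (hβ : 0 < β) (hJ : 0 < J) {x : ℝ} (hx : |x| ≤ 1)
    {ι : Type*} {l : Filter ι} {N : ι → ℕ} {p : ι → ℝ × ℝ} (hN : Tendsto N l atTop)
    (hconc : ∀ ε > 0, Tendsto (fun i =>
      (∫ ζ in {ζ | ε ≤ |(gnomonic ζ).1 - x|}, planeWeight (N i) β J (p i) ζ) /
        ∫ ζ, planeWeight (N i) β J (p i) ζ) l (𝓝 0)) :
    Tendsto (fun i => planeMagnetization (N i) β J (p i)) l (𝓝 x) := by
  rw [Metric.tendsto_nhds]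
  intro ε hε
  filter_upwards [(hconc (ε / 2) (by positivity)).eventually (gt_mem_nhds
    (show (0 : ℝ) < ε / 4 by positivity)), hN.eventually_ge_atTop 3] with i hi hNi
  have hint := integrable_planeWeight hNi hβ hJ (p i)
  have hpos := integral_planeWeight_pos hNi hβ hJ (p i)
  set w := planeWeight (N i) β J (p i)
  set K : Set (ℝ × ℝ) := {ζ | ε / 2 ≤ |(gnomonic ζ).1 - x|}
  have hg : Continuous fun ζ => (gnomonic ζ).1 := continuous_fst.comp continuous_gnomonic
  have hK : MeasurableSet K := (isClosed_le continuous_const (hg.sub continuous_const).abs).measurableSet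
  have hw0 : ∀ ζ, 0 < w ζ := planeWeight_pos _ _ _ _
  have hg1 : ∀ ζ, |(gnomonic ζ).1| ≤ 1 := fun ζ =>
    (abs_le_one_of_mem_unitDisc (gnomonic_mem_unitDisc ζ)).1
  have hgint : Integrable fun ζ => (gnomonic ζ).1 * w ζ :=
    hint.bdd_mul (c := 1) hg.aestronglyMeasurable (ae_of_all _ hg1)
  have hsub : planeMagnetization (N i) β J (p i) - x =
      (∫ ζ, ((gnomonic ζ).1 - x) * w ζ) / ∫ ζ, w ζ := by
    simp_rw [sub_mul]
    rw [integral_sub hgint (hint.const_mul x), integral_const_mul, sub_div,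
      mul_div_cancel_right₀ _ hpos.ne']
    rfl
  rw [Real.dist_eq, hsub, abs_div, abs_of_pos hpos, div_lt_iff₀ hpos]
  rw [div_lt_iff₀ hpos] at hi
  calc |∫ ζ, ((gnomonic ζ).1 - x) * w ζ| ≤ ∫ ζ, |((gnomonic ζ).1 - x) * w ζ| :=
        abs_integral_le_integral_abs
    _ ≤ ∫ ζ, (ε / 2 * w ζ + 2 * K.indicator w ζ) := by
        refine integral_mono_of_nonneg (ae_of_all _ fun ζ => abs_nonneg _)
          ((hint.const_mul _).add ((hint.indicator hK).const_mul _)) (ae_of_all _ fun ζ => ?_)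
        change |((gnomonic ζ).1 - x) * w ζ| ≤ ε / 2 * w ζ + 2 * K.indicator w ζ
        rw [abs_mul, abs_of_pos (hw0 ζ)]
        by_cases hζ : ζ ∈ K
        · rw [Set.indicator_of_mem hζ]
          have : |(gnomonic ζ).1 - x| ≤ 2 := (abs_sub _ _).trans (by linarith [hg1 ζ])
          nlinarith [hw0 ζ]
        · rw [Set.indicator_of_notMem hζ, mul_zero, add_zero]
          exact mul_le_mul_of_nonneg_right (not_le.1 hζ).le (hw0 ζ).le
    _ = ε / 2 * (∫ ζ, w ζ) + 2 * ∫ ζ in K, w ζ := by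
        rw [integral_add (hint.const_mul _) ((hint.indicator hK).const_mul _), integral_const_mul,
          integral_const_mul, integral_indicator hK]
    _ < ε * ∫ ζ, w ζ := by linarith

theorem tendsto_planeMagnetization_of_unique (hβ : 0 < β) (hJ : 0 < J) {m : ℝ × ℝ} {x : ℝ}
    (hx : |x| ≤ 1)
    (hmax : ∀ ζ, (∀ ζ', planeTilting β J m ζ' ≤ planeTilting β J m ζ) → (gnomonic ζ).1 = x)
    {ι : Type*} {l : Filter ι} {N : ι → ℕ} {p : ι → ℝ × ℝ} (hN : Tendsto N l atTop)
    (hp : Tendsto p l (𝓝 m)) :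
    Tendsto (fun i => planeMagnetization (N i) β J (p i)) l (𝓝 x) := by
  have hg : Continuous fun ζ => (gnomonic ζ).1 := continuous_fst.comp continuous_gnomonic
  refine tendsto_planeMagnetization_of_concentration hβ hJ hx hN fun ε hε => ?_
  refine tendsto_setIntegral_planeWeight_div hβ hJ
    (isClosed_le continuous_const (hg.sub continuous_const).abs) (fun ζ hζ => ?_) hN hp
  by_contra! hcon
  have h1 : ε ≤ |(gnomonic ζ).1 - x| := hζ
  rw [hmax ζ hcon, sub_self, abs_zero] at h1
  linarith

/-- Reflection of the first coordinate. -/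
def reflectFst : ℝ × ℝ ≃ᵐ ℝ × ℝ := (MeasurableEquiv.neg ℝ).prodCongr (MeasurableEquiv.refl ℝ)

lemma reflectFst_apply (ζ : ℝ × ℝ) : reflectFst ζ = (-ζ.1, ζ.2) := rfl

lemma measurePreserving_reflectFst : MeasurePreserving reflectFst :=
  (Measure.measurePreserving_neg volume).prod (MeasurePreserving.id volume)

lemma gnomonic_reflectFst (ζ : ℝ × ℝ) : gnomonic (reflectFst ζ) = reflectFst (gnomonic ζ) := by
  simp [gnomonic, reflectFst_apply, neg_div]

/-- Only the term of the energy that is odd in the first coordinate changes under the reflection. -/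
lemma planeWeight_reflectFst (n : ℕ) (p ζ : ℝ × ℝ) :
    planeWeight n β J p (reflectFst ζ) =
      Real.exp (-(2 * β * (n * p.1) * (gnomonic ζ).1)) * planeWeight n β J p ζ := by
  have h : planeDensity n (reflectFst ζ) = planeDensity n ζ := by
    simp [planeDensity, reflectFst_apply]
  rw [planeWeight, planeWeight, h, ← mul_assoc, ← Real.exp_add, gnomonic_reflectFst]
  congr 2
  simp only [energy, reflectFst_apply]
  ring

lemma planeMagnetization_reflectFst (n : ℕ) (p : ℝ × ℝ) :
    planeMagnetization n β J (reflectFst p) = -planeMagnetization n β J p := by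
  have h : ∀ ζ, planeWeight n β J (reflectFst p) (reflectFst ζ) = planeWeight n β J p ζ := by
    intro ζ
    have h : planeDensity n (reflectFst ζ) = planeDensity n ζ := by
      simp [planeDensity, reflectFst_apply]
    rw [planeWeight, planeWeight, h, gnomonic_reflectFst]
    congr 3
    simp only [energy, reflectFst_apply]
    ring
  rw [planeMagnetization, ← measurePreserving_reflectFst.integral_comp',
    ← measurePreserving_reflectFst.integral_comp' (fun ζ => planeWeight n β J (reflectFst p) ζ)]
  simp_rw [h, gnomonic_reflectFst, reflectFst_apply, neg_mul]
  rw [integral_neg, neg_div]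
  rfl

/-- Both peaks have the same limiting height; the hypothesis that n times the sample mean diverges
suppresses the left one exponentially. -/
theorem tendsto_planeMagnetization_of_pair (hβ : 0 < β) (hJ : 0 < J) {m : ℝ × ℝ} {x : ℝ}
    (hx0 : 0 < x) (hx : |x| ≤ 1)
    (hmax : ∀ ζ, (∀ ζ', planeTilting β J m ζ' ≤ planeTilting β J m ζ) → |(gnomonic ζ).1| = x)
    {ι : Type*} {l : Filter ι} {N : ι → ℕ} {p : ι → ℝ × ℝ} (hN : Tendsto N l atTop)
    (hp : Tendsto p l (𝓝 m)) (hNp : Tendsto (fun i => N i * (p i).1) l atTop) :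
    Tendsto (fun i => planeMagnetization (N i) β J (p i)) l (𝓝 x) := by
  have hg : Continuous fun ζ => (gnomonic ζ).1 := continuous_fst.comp continuous_gnomonic
  refine tendsto_planeMagnetization_of_concentration hβ hJ hx hN fun ε hε => ?_
  -- K avoids both peaks, so Laplace's method handles it. The threshold x/2 puts the rest of the bad
  -- set in L, around the left peak, which is compared with its mirror image.
  set K : Set (ℝ × ℝ) := {ζ | min ε (x / 2) ≤ |(gnomonic ζ).1 - x| ∧
    min ε (x / 2) ≤ |(gnomonic ζ).1 + x|} with hK
  set L : Set (ℝ × ℝ) := {ζ | (gnomonic ζ).1 ≤ -(x / 2)} with hL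
  have hKc : IsClosed K := (isClosed_le continuous_const (hg.sub continuous_const).abs).inter
    (isClosed_le continuous_const (hg.add continuous_const).abs)
  have hLc : IsClosed L := isClosed_le hg continuous_const
  have h1 := tendsto_setIntegral_planeWeight_div hβ hJ hKc (fun ζ hζ => by
    by_contra! hcon
    have h2 := hmax ζ hcon
    have h3 : 0 < min ε (x / 2) := lt_min hε (by linarith)
    rcases (abs_eq hx0.le).1 h2 with h | h
    · have := hζ.1; rw [h, sub_self, abs_zero] at this; linarith
    · have := hζ.2; rw [h, neg_add_cancel, abs_zero] at this; linarith) hN hp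
  have h2 : Tendsto (fun i => Real.exp (-(β * x * (N i * (p i).1)))) l (𝓝 0) :=
    Real.tendsto_exp_neg_atTop_nhds_zero.comp (hNp.const_mul_atTop (mul_pos hβ hx0))
  have h3 := h1.add h2
  rw [add_zero] at h3
  refine squeeze_zero' (Eventually.of_forall fun i => div_nonneg
      (integral_nonneg fun ζ => (planeWeight_pos _ _ _ _ _).le)
      (integral_nonneg fun ζ => (planeWeight_pos _ _ _ _ _).le)) ?_ h3
  filter_upwards [hN.eventually_ge_atTop 3, hNp.eventually_ge_atTop 0] with i hNi hNpi
  have hint := integrable_planeWeight hNi hβ hJ (p i)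
  have hpos := integral_planeWeight_pos hNi hβ hJ (p i)
  have hw0 : ∀ ζ, 0 < planeWeight (N i) β J (p i) ζ := planeWeight_pos _ _ _ _
  rw [div_le_iff₀ hpos, add_mul, div_mul_cancel₀ _ hpos.ne']
  have hsub : {ζ | ε ≤ |(gnomonic ζ).1 - x|} ⊆ K ∪ L := by
    intro ζ hζ
    have hζ' : ε ≤ |(gnomonic ζ).1 - x| := hζ
    by_cases h : min ε (x / 2) ≤ |(gnomonic ζ).1 + x|
    · exact Or.inl ⟨(min_le_left _ _).trans hζ', h⟩
    · right
      have := (abs_lt.1 ((not_le.1 h).trans_le (min_le_right _ _))).2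
      change (gnomonic ζ).1 ≤ -(x / 2)
      linarith
  have hLint : ∫ ζ in L, planeWeight (N i) β J (p i) ζ ≤
      Real.exp (-(β * x * (N i * (p i).1))) * ∫ ζ, planeWeight (N i) β J (p i) ζ := by
    rw [← integral_indicator hLc.measurableSet, ← measurePreserving_reflectFst.integral_comp',
      ← integral_const_mul]
    refine integral_mono_of_nonneg (ae_of_all _ fun ζ =>
      Set.indicator_nonneg (fun ζ _ => (hw0 ζ).le) _) (hint.const_mul _) (ae_of_all _ fun ζ => ?_)
    change L.indicator (planeWeight (N i) β J (p i)) (reflectFst ζ) ≤ _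
    by_cases hζ : reflectFst ζ ∈ L
    · rw [Set.indicator_of_mem hζ, planeWeight_reflectFst]
      refine mul_le_mul_of_nonneg_right (Real.exp_le_exp.2 (neg_le_neg ?_)) (hw0 ζ).le
      have : -(gnomonic ζ).1 ≤ -(x / 2) := by
        have h : (gnomonic (reflectFst ζ)).1 ≤ -(x / 2) := hζ
        rwa [gnomonic_reflectFst] at h
      nlinarith [mul_le_mul_of_nonneg_left (neg_le_neg_iff.1 this) (mul_nonneg hβ.le hNpi)]
    · rw [Set.indicator_of_notMem hζ]
      exact (mul_pos (Real.exp_pos _) (hw0 ζ)).le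
  calc ∫ ζ in {ζ | ε ≤ |(gnomonic ζ).1 - x|}, planeWeight (N i) β J (p i) ζ
      ≤ ∫ ζ in K ∪ L, planeWeight (N i) β J (p i) ζ :=
        setIntegral_mono_set hint.integrableOn (ae_of_all _ fun ζ => (hw0 ζ).le)
          (LE.le.eventuallyLE hsub)
    _ ≤ (∫ ζ in K, planeWeight (N i) β J (p i) ζ) + ∫ ζ in L, planeWeight (N i) β J (p i) ζ := by
        rw [← Set.union_sdiff_self, setIntegral_union Set.disjoint_sdiff_right
          (hLc.measurableSet.diff hKc.measurableSet) hint.integrableOn hint.integrableOn]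
        exact add_le_add_right (setIntegral_mono_set hint.integrableOn
          (ae_of_all _ fun ζ => (hw0 ζ).le) (LE.le.eventuallyLE Set.sdiff_subset)) _
    _ ≤ _ := by linarith

end Laplace

end MeanFieldSpherical

/-! ### Maximizers of the tilting function -/

namespace MeanFieldSpherical

section Maximizers

variable {β J : ℝ}

lemma gnomonic_mem_maximizers {m ζ : ℝ × ℝ}
    (h : ∀ ζ', planeTilting β J m ζ' ≤ planeTilting β J m ζ) : gnomonic ζ ∈ maximizers β J m := by
  refine ⟨gnomonic_mem_unitDisc ζ, fun w hw => ?_⟩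
  obtain ⟨ζ', rfl⟩ := exists_gnomonic_eq hw
  exact h ζ'

lemma maximizers_nonempty (hβ : 0 < β) (hJ : 0 < J) (m : ℝ × ℝ) : (maximizers β J m).Nonempty := by
  obtain ⟨ζ, hζ⟩ := exists_forall_planeTilting_le hβ hJ m
  exact ⟨_, gnomonic_mem_maximizers hζ⟩

lemma neg_fst_mem_unitDisc {z : ℝ × ℝ} : (-z.1, z.2) ∈ unitDisc ↔ z ∈ unitDisc := by
  simp [unitDisc]

lemma tilting_neg_fst (m z : ℝ × ℝ) :
    tilting β J (-m.1, m.2) (-z.1, z.2) = tilting β J m z := by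
  simp [tilting]

lemma neg_fst_mem_maximizers {m z : ℝ × ℝ} (hz : z ∈ maximizers β J m) :
    (-z.1, z.2) ∈ maximizers β J (-m.1, m.2) := by
  refine ⟨neg_fst_mem_unitDisc.2 hz.1, fun w hw => ?_⟩
  have h := hz.2 _ (neg_fst_mem_unitDisc.2 hw)
  have e := tilting_neg_fst (β := β) (J := J) m (-w.1, w.2)
  rw [neg_neg] at e
  exact e.le.trans (h.trans (tilting_neg_fst m z).ge)

lemma one_sub_pos_of_mem_unitDisc {z : ℝ × ℝ} (hz : z ∈ unitDisc) :
    0 < 1 - (z.1 ^ 2 + z.2 ^ 2) := by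
  have : z.1 ^ 2 + z.2 ^ 2 < 1 := hz
  linarith

lemma fst_critical {m z : ℝ × ℝ} (hz : z ∈ maximizers β J m) :
    (β * J * z.1 + β * m.1) * (1 - (z.1 ^ 2 + z.2 ^ 2)) = z.1 := by
  have hD := one_sub_pos_of_mem_unitDisc hz.1
  have hder : HasDerivAt (fun t : ℝ => tilting β J m (t, z.2))
      (β * J / 2 * (2 * z.1) + β * m.1 + 1 / 2 * (-(2 * z.1) / (1 - (z.1 ^ 2 + z.2 ^ 2)))) z.1 := by
    have h1 : HasDerivAt (fun t : ℝ => t ^ 2) (2 * z.1) z.1 := by simpa using hasDerivAt_pow 2 z.1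
    have h2 : HasDerivAt (fun t : ℝ => 1 - (t ^ 2 + z.2 ^ 2)) (-(2 * z.1)) z.1 :=
      (h1.add_const _).const_sub 1
    have h3 : HasDerivAt (fun t : ℝ => β * (m.1 * t + m.2 * z.2)) (β * m.1) z.1 := by
      simpa using (((hasDerivAt_id z.1).const_mul m.1).add_const (m.2 * z.2)).const_mul β
    exact ((h1.const_mul _).add h3).add ((h2.log hD.ne').const_mul _)
  have hmax : IsLocalMax (fun t : ℝ => tilting β J m (t, z.2)) z.1 := by
    have hU : {t : ℝ | t ^ 2 + z.2 ^ 2 < 1} ∈ 𝓝 z.1 :=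
      (isOpen_lt (by fun_prop) continuous_const).mem_nhds hz.1
    filter_upwards [hU] with t ht using hz.2 (t, z.2) ht
  have h0 := hmax.hasDerivAt_eq_zero hder
  field_simp at h0
  linarith

lemma snd_critical {m z : ℝ × ℝ} (hz : z ∈ maximizers β J m) :
    β * m.2 * (1 - (z.1 ^ 2 + z.2 ^ 2)) = z.2 := by
  have hD := one_sub_pos_of_mem_unitDisc hz.1
  have hder : HasDerivAt (fun t : ℝ => tilting β J m (z.1, t))
      (β * m.2 + 1 / 2 * (-(2 * z.2) / (1 - (z.1 ^ 2 + z.2 ^ 2)))) z.2 := by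
    have h1 : HasDerivAt (fun t : ℝ => t ^ 2) (2 * z.2) z.2 := by simpa using hasDerivAt_pow 2 z.2
    have h2 : HasDerivAt (fun t : ℝ => 1 - (z.1 ^ 2 + t ^ 2)) (-(2 * z.2)) z.2 :=
      (h1.const_add _).const_sub 1
    have h3 : HasDerivAt (fun t : ℝ => β * (m.1 * z.1 + m.2 * t)) (β * m.2) z.2 := by
      simpa using (((hasDerivAt_id z.2).const_mul m.2).const_add (m.1 * z.1)).const_mul β
    exact (h3.const_add (β * J / 2 * z.1 ^ 2)).add ((h2.log hD.ne').const_mul (1 / 2))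
  have hmax : IsLocalMax (fun t : ℝ => tilting β J m (z.1, t)) z.2 := by
    have hU : {t : ℝ | z.1 ^ 2 + t ^ 2 < 1} ∈ 𝓝 z.2 :=
      (isOpen_lt (by fun_prop) continuous_const).mem_nhds hz.1
    filter_upwards [hU] with t ht using hz.2 (z.1, t) ht
  have h0 := hmax.hasDerivAt_eq_zero hder
  field_simp at h0
  linarith

lemma snd_pos_of_mem_maximizers (hβ : 0 < β) {m z : ℝ × ℝ} (hm : 0 < m.2)
    (hz : z ∈ maximizers β J m) : 0 < z.2 := by
  rw [← snd_critical hz]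
  exact mul_pos (mul_pos hβ hm) (one_sub_pos_of_mem_unitDisc hz.1)

/-- Comparison with the reflected point excludes a negative first coordinate, and the critical
equation excludes zero. -/
lemma fst_pos_of_mem_maximizers (hβ : 0 < β) {m z : ℝ × ℝ} (hm : 0 < m.1)
    (hz : z ∈ maximizers β J m) : 0 < z.1 := by
  have h1 := hz.2 _ (neg_fst_mem_unitDisc.2 hz.1)
  simp only [tilting, neg_sq] at h1
  have h2 : 0 ≤ β * m.1 * z.1 := by linarith
  have h3 : 0 ≤ z.1 := nonneg_of_mul_nonneg_right h2 (mul_pos hβ hm)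
  refine lt_of_le_of_ne h3 fun h => ?_
  have h4 := fst_critical hz
  have hD := one_sub_pos_of_mem_unitDisc hz.1
  rw [← h, mul_zero, zero_add] at h4
  rw [← h] at hD
  exact (mul_pos (mul_pos hβ hm) hD).ne' h4

lemma half_add_le_sqrt (a b : ℝ) : (a + b) / 2 ≤ √((a ^ 2 + b ^ 2) / 2) :=
  Real.le_sqrt_of_sq_le (by nlinarith [sq_nonneg (a - b)])

/-- In the squared coordinates the tilting function is strictly concave on the quadrant. -/
lemma eq_of_mem_maximizers (hβ : 0 < β) {m z z' : ℝ × ℝ} (hm1 : 0 ≤ m.1)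
    (hm2 : 0 < m.2) (hz : z ∈ maximizers β J m) (hz' : z' ∈ maximizers β J m) (h1 : 0 ≤ z.1)
    (h1' : 0 ≤ z'.1) : z = z' := by
  have hy := snd_pos_of_mem_maximizers hβ hm2 hz
  have hy' := snd_pos_of_mem_maximizers hβ hm2 hz'
  have hD := one_sub_pos_of_mem_unitDisc hz.1
  have hD' := one_sub_pos_of_mem_unitDisc hz'.1
  -- The competitor (√u, √v) is the midpoint in squared coordinates. The quadratic term is affine
  -- there, square roots are concave, and the logarithm is strictly concave in the affine quantity
  -- D. Equality then forces D = D', next y = y' as m^⊥ > 0, and finally x² = x'².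
  set u := (z.1 ^ 2 + z'.1 ^ 2) / 2
  set v := (z.2 ^ 2 + z'.2 ^ 2) / 2
  set D := 1 - (z.1 ^ 2 + z.2 ^ 2)
  set D' := 1 - (z'.1 ^ 2 + z'.2 ^ 2)
  have hu : √u ^ 2 = u := Real.sq_sqrt (by positivity)
  have hv : √v ^ 2 = v := Real.sq_sqrt (by positivity)
  have hDw : 1 - (√u ^ 2 + √v ^ 2) = (1 / 2 : ℝ) • D + (1 / 2 : ℝ) • D' := by
    rw [hu, hv]; simp only [u, v, D, D', smul_eq_mul]; ring
  have hw : (√u, √v) ∈ unitDisc := by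
    change √u ^ 2 + √v ^ 2 < 1
    simp only [smul_eq_mul] at hDw
    linarith
  have hle := hz.2 _ hw
  have hle' := hz'.2 _ hw
  have hx2 : (z.1 + z'.1) / 2 ≤ √u := half_add_le_sqrt _ _
  have hy2 : (z.2 + z'.2) / 2 ≤ √v := half_add_le_sqrt _ _
  have hlog : (1 / 2 : ℝ) * Real.log D + 1 / 2 * Real.log D' ≤
      Real.log (1 - (√u ^ 2 + √v ^ 2)) := by
    rw [hDw]
    exact strictConcaveOn_log_Ioi.concaveOn.2 hD hD' (by norm_num) (by norm_num) (by norm_num)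
  simp only [tilting] at hle hle'
  have hmx : m.1 * ((z.1 + z'.1) / 2) ≤ m.1 * √u := mul_le_mul_of_nonneg_left hx2 hm1
  have hmy : m.2 * ((z.2 + z'.2) / 2) ≤ m.2 * √v := mul_le_mul_of_nonneg_left hy2 hm2.le
  have hbx := mul_le_mul_of_nonneg_left hmx hβ.le
  have hby := mul_le_mul_of_nonneg_left hmy hβ.le
  have hu' : β * J / 2 * √u ^ 2 = 1 / 2 * (β * J / 2 * z.1 ^ 2) + 1 / 2 * (β * J / 2 * z'.1 ^ 2) := by
    rw [hu]; simp only [u]; ring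
  rw [hu'] at hle hle'
  have hDD : D = D' := by
    by_contra hne
    have := strictConcaveOn_log_Ioi.2 hD hD' hne (by norm_num : (0 : ℝ) < 1 / 2)
      (by norm_num : (0 : ℝ) < 1 / 2) (by norm_num)
    rw [← hDw, smul_eq_mul, smul_eq_mul] at this
    simp only [D, D'] at this
    linarith
  have hyy : z.2 = z'.2 := by
    by_contra hne
    have hlt : (z.2 + z'.2) / 2 < √v := by
      refine Real.lt_sqrt_of_sq_lt ?_
      have := sq_pos_of_ne_zero (sub_ne_zero.2 hne)
      simp only [v]
      nlinarith
    have := mul_lt_mul_of_pos_left (mul_lt_mul_of_pos_left hlt hm2) hβ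
    simp only [D, D'] at hlog
    linarith
  have hxx : z.1 ^ 2 = z'.1 ^ 2 := by
    simp only [D, D', hyy] at hDD; linarith
  exact Prod.ext ((sq_eq_sq₀ h1 h1').1 hxx) hyy

theorem exists_maximizers_eq_singleton (hβ : 0 < β) (hJ : 0 < J) {m : ℝ × ℝ} (hm1 : m.1 ≠ 0)
    (hm2 : 0 < m.2) : ∃ z, maximizers β J m = {z} ∧ z.1 ≠ 0 := by
  obtain ⟨z, hz⟩ := maximizers_nonempty hβ hJ m
  rcases lt_or_gt_of_ne hm1 with h | h
  · have hpos : ∀ w ∈ maximizers β J m, 0 < (-w.1, w.2).1 := fun w hw =>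
      fst_pos_of_mem_maximizers hβ (m := (-m.1, m.2)) (neg_pos.2 h) (neg_fst_mem_maximizers hw)
    refine ⟨z, Set.eq_singleton_iff_unique_mem.2 ⟨hz, fun w hw => ?_⟩, ?_⟩
    · have := eq_of_mem_maximizers hβ (m := (-m.1, m.2)) (neg_pos.2 h).le hm2
        (neg_fst_mem_maximizers hw) (neg_fst_mem_maximizers hz) (hpos w hw).le (hpos z hz).le
      simp only [Prod.mk.injEq, neg_inj] at this
      exact Prod.ext this.1 this.2
    · have := hpos z hz
      simp only at this
      linarith
  · have hpos : ∀ w ∈ maximizers β J m, 0 < w.1 := fun w hw => fst_pos_of_mem_maximizers hβ h hw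
    exact ⟨z, Set.eq_singleton_iff_unique_mem.2 ⟨hz, fun w hw =>
      eq_of_mem_maximizers hβ h.le hm2 hw hz (hpos w hw).le (hpos z hz).le⟩, (hpos z hz).ne'⟩

/-- Dividing the first critical equation by x > 0 gives βJ(1-|z|²) = 1, hence y = m^⊥/J and x² = 1 -
1/(βJ) - (m^⊥/J)². Positivity of x² is the claim. -/
lemma lt_and_criticalBeta_lt_of_fst_pos (hβ : 0 < β) (hJ : 0 < J) {m z : ℝ × ℝ} (hm1 : m.1 = 0)
    (hm2 : 0 < m.2) (hz : z ∈ maximizers β J m) (hz1 : 0 < z.1) :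
    m.2 < J ∧ criticalBeta J m.2 < β := by
  have hx := fst_critical hz
  have hy := snd_critical hz
  set D := 1 - (z.1 ^ 2 + z.2 ^ 2) with hD
  rw [hm1, mul_zero, add_zero] at hx
  have h1 : β * J * D = 1 := by
    have : z.1 * (β * J * D) = z.1 * 1 := by linarith
    exact mul_left_cancel₀ hz1.ne' this
  have h2 : J * z.2 = m.2 := by rw [← hy]; linear_combination m.2 * h1
  have h3 : z.2 ^ 2 < 1 := by
    have := one_sub_pos_of_mem_unitDisc hz.1
    nlinarith [sq_nonneg z.1]
  have hlt : m.2 < J := by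
    rw [← h2]
    refine mul_lt_of_lt_one_right hJ ?_
    nlinarith
  refine ⟨hlt, ?_⟩
  rw [criticalBeta, div_lt_iff₀ (mul_pos (by linarith) (by linarith)), ← h2]
  have h4 : z.1 ^ 2 = 1 - D - z.2 ^ 2 := by rw [hD]; ring
  have h5 : 0 < β * J ^ 2 * z.1 ^ 2 := by positivity
  rw [h4] at h5
  nlinarith

/-- A maximizer on the axis x = 0 must resist small displacements in x, which forces βJ(1-y²) ≤ 1.
With the critical equation for y this contradicts β > β_c. -/
lemma criticalBeta_ge_of_fst_eq_zero (hβ : 0 < β) (hJ : 0 < J) {m z : ℝ × ℝ}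
    (hm2 : 0 < m.2) (hz : z ∈ maximizers β J m) (hz1 : z.1 = 0) :
    ¬ (m.2 < J ∧ criticalBeta J m.2 < β) := by
  rintro ⟨hlt, hc⟩
  have hy := snd_critical hz
  have hy0 := snd_pos_of_mem_maximizers hβ hm2 hz
  have hD := one_sub_pos_of_mem_unitDisc hz.1
  rw [hz1, zero_pow two_ne_zero, zero_add] at hy hD
  set D := 1 - z.2 ^ 2 with hDdef
  have hm1 : m.1 = 0 := by
    have h := fst_critical hz
    rw [hz1, mul_zero, zero_add, zero_pow two_ne_zero, zero_add] at h
    rcases mul_eq_zero.1 h with h | h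
    · exact (mul_eq_zero.1 h).resolve_left hβ.ne'
    · exact absurd h hD.ne'
  have hkey : β * J * D ≤ 1 := by
    -- The test point has x² = tD, so its distance term is D(1-t) and the logarithm splits. Small t
    -- then gives the second-order condition.
    have hineq : ∀ t ∈ Set.Ioo (0 : ℝ) 1, β * J * D * (1 - t) ≤ 1 := by
      intro t ht
      have htD : 0 < t * D := mul_pos ht.1 hD
      have hs : √(t * D) ^ 2 = t * D := Real.sq_sqrt htD.le
      have h1t : 0 < 1 - t := by linarith [ht.2]
      have hval : 1 - (t * D + z.2 ^ 2) = D * (1 - t) := by rw [hDdef]; ring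
      have hw : (√(t * D), z.2) ∈ unitDisc := by
        change √(t * D) ^ 2 + z.2 ^ 2 < 1
        rw [hs]
        nlinarith [mul_pos hD h1t]
      have h := hz.2 _ hw
      simp only [tilting] at h
      rw [hs, hz1, hm1, hval, Real.log_mul hD.ne' h1t.ne', zero_pow two_ne_zero, zero_add,
        ← hDdef] at h
      have hl := Real.one_sub_inv_le_log_of_pos h1t
      have h2 : β * J * (t * D) ≤ (1 - t)⁻¹ - 1 := by linarith
      have h3 : (1 - t)⁻¹ - 1 = t / (1 - t) := by field_simp; ring
      rw [h3, le_div_iff₀ h1t] at h2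
      refine le_of_mul_le_mul_left ?_ ht.1
      linarith
    by_contra! hcon
    have hq : 0 < 1 - (β * J * D)⁻¹ := by linarith [inv_lt_one_of_one_lt₀ hcon]
    have hp : 0 < (β * J * D)⁻¹ := by positivity
    have h := hineq ((1 - (β * J * D)⁻¹) / 2) ⟨by linarith, by linarith⟩
    have h4 : β * J * D * (1 - (1 - (β * J * D)⁻¹) / 2) = (β * J * D + 1) / 2 := by
      field_simp; ring
    linarith
  rw [criticalBeta, div_lt_iff₀ (mul_pos (by linarith) (by linarith))] at hc
  have hle : J * z.2 ≤ m.2 := by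
    rw [← hy]; nlinarith
  have hsq : J ^ 2 * z.2 ^ 2 ≤ m.2 ^ 2 := by
    rw [← mul_pow]; exact pow_le_pow_left₀ (by positivity) hle 2
  have h6 : β * (J ^ 2 - m.2 ^ 2) ≤ β * (J ^ 2 * D) := by
    refine mul_le_mul_of_nonneg_left ?_ hβ.le
    rw [hDdef]; linarith
  nlinarith

theorem exists_maximizers_eq_pair (hβ : 0 < β) (hJ : 0 < J) {m : ℝ × ℝ} (hm1 : m.1 = 0)
    (hm2 : 0 < m.2) : ∃ z, maximizers β J m = {z, (-z.1, z.2)} ∧ 0 ≤ z.1 ∧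
      (0 < z.1 ↔ m.2 < J ∧ criticalBeta J m.2 < β) := by
  have hneg : ∀ w ∈ maximizers β J m, (-w.1, w.2) ∈ maximizers β J m := fun w hw => by
    have := neg_fst_mem_maximizers hw
    rwa [hm1, neg_zero, ← hm1] at this
  obtain ⟨z, hz, hz1⟩ : ∃ z ∈ maximizers β J m, 0 ≤ z.1 := by
    obtain ⟨z, hz⟩ := maximizers_nonempty hβ hJ m
    rcases le_total 0 z.1 with h | h
    · exact ⟨z, hz, h⟩
    · exact ⟨_, hneg z hz, neg_nonneg.2 h⟩
  refine ⟨z, Set.Subset.antisymm (fun w hw => ?_) ?_, hz1, fun h => ?_, fun h => ?_⟩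
  · rcases le_total 0 w.1 with h | h
    · exact Or.inl (eq_of_mem_maximizers hβ hm1.ge hm2 hw hz h hz1)
    · right
      have := eq_of_mem_maximizers hβ hm1.ge hm2 (hneg w hw) hz (neg_nonneg.2 h) hz1
      rw [← this]
      simp
  · rintro w (rfl | rfl)
    · exact hz
    · exact hneg z hz
  · exact lt_and_criticalBeta_lt_of_fst_pos hβ hJ hm1 hm2 hz h
  · exact lt_of_le_of_ne hz1 fun h0 => criticalBeta_ge_of_fst_eq_zero hβ hJ hm2 hz h0.symm h

end Maximizers

end MeanFieldSpherical

/-! ### Boundedness, measurability and moments -/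

namespace MeanFieldSpherical

open scoped ENNReal

instance isFiniteMeasure_sphereUniform (n : ℕ) : IsFiniteMeasure (sphereUniform n) := by
  have : IsFiniteMeasure (((volume : Measure (EuclideanSpace ℝ (Fin n))).toSphere Set.univ)⁻¹ •
      (volume : Measure (EuclideanSpace ℝ (Fin n))).toSphere) := by
    -- In dimension 0 the sphere is empty and the normalizing factor is infinite, but it multiplies
    -- the zero measure.
    by_cases h : (volume : Measure (EuclideanSpace ℝ (Fin n))).toSphere = 0
    · rw [h, smul_zero]; infer_instance
    · exact Measure.smul_finite _ (ENNReal.inv_ne_top.2 (Measure.measure_univ_eq_zero.not.2 h))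
  unfold sphereUniform
  infer_instance

lemma ae_sphereUniform_norm_sq (n : ℕ) : ∀ᵐ φ ∂sphereUniform n, ‖φ‖ ^ 2 = n := by
  unfold sphereUniform
  rw [ae_map_iff (by fun_prop) (measurableSet_eq_fun (by fun_prop) (by fun_prop))]
  refine ae_of_all _ fun θ => ?_
  rw [norm_smul, norm_eq_of_mem_sphere, mul_one, Real.norm_of_nonneg (Real.sqrt_nonneg _),
    Real.sq_sqrt n.cast_nonneg]

lemma ae_sphereUniform_abs_mean_le_one (n : ℕ) :
    ∀ᵐ φ ∂sphereUniform n, |(∑ i, φ i) / (n : ℝ)| ≤ 1 := by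
  filter_upwards [ae_sphereUniform_norm_sq n] with φ hφ
  have h := sq_sum_le_card_mul_sum_sq (s := Finset.univ) (f := fun i => φ i)
  rw [EuclideanSpace.norm_sq_eq] at hφ
  simp only [Real.norm_eq_abs, sq_abs] at hφ
  rw [hφ, Finset.card_univ, Fintype.card_fin, ← sq] at h
  rw [abs_div, Nat.abs_cast]
  exact div_le_one_of_le₀ (abs_le_of_sq_le_sq h n.cast_nonneg) n.cast_nonneg

theorem abs_magnetizationDensity_le_one (n : ℕ) (β J : ℝ) (h : ℕ → ℝ) :
    |magnetizationDensity n β J h| ≤ 1 := by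
  rw [magnetizationDensity_eq]
  by_cases hint : Integrable (fun φ => Real.exp (-β * hamiltonian n J h φ)) (sphereUniform n)
  · have h0 : 0 ≤ ∫ φ, Real.exp (-β * hamiltonian n J h φ) ∂(sphereUniform n) :=
      integral_nonneg fun φ => (Real.exp_pos _).le
    rw [abs_div, abs_of_nonneg h0]
    refine div_le_one_of_le₀ ?_ h0
    rw [← Real.norm_eq_abs]
    refine norm_integral_le_of_norm_le hint ?_
    filter_upwards [ae_sphereUniform_abs_mean_le_one n] with φ hφ
    rw [norm_mul, Real.norm_eq_abs, Real.norm_of_nonneg (Real.exp_pos _).le]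
    exact mul_le_of_le_one_left (Real.exp_pos _).le hφ
  · rw [integral_undef hint, div_zero, abs_zero]
    exact zero_le_one

theorem measurable_magnetizationDensity (n : ℕ) (β J : ℝ) :
    Measurable (magnetizationDensity n β J) := by
  rw [funext (magnetizationDensity_eq n β J)]
  have hH : Measurable fun q : (ℕ → ℝ) × EuclideanSpace ℝ (Fin n) => hamiltonian n J q.1 q.2 := by
    unfold hamiltonian; fun_prop
  have h1 : StronglyMeasurable fun h : ℕ → ℝ =>
      ∫ φ, ((∑ i, φ i) / n) * Real.exp (-β * hamiltonian n J h φ) ∂(sphereUniform n) :=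
    StronglyMeasurable.integral_prod_right' (f := fun q : (ℕ → ℝ) × EuclideanSpace ℝ (Fin n) =>
      ((∑ i, q.2 i) / n) * Real.exp (-β * hamiltonian n J q.1 q.2))
      (Measurable.stronglyMeasurable (by fun_prop))
  have h2 : StronglyMeasurable fun h : ℕ → ℝ =>
      ∫ φ, Real.exp (-β * hamiltonian n J h φ) ∂(sphereUniform n) :=
    StronglyMeasurable.integral_prod_right' (f := fun q : (ℕ → ℝ) × EuclideanSpace ℝ (Fin n) =>
      Real.exp (-β * hamiltonian n J q.1 q.2)) (Measurable.stronglyMeasurable (by fun_prop))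
  exact h1.measurable.div h2.measurable

section Moments

variable {Ω : Type*} [MeasurableSpace Ω] {P : Measure Ω} [IsProbabilityMeasure P]

/-- On [-1, 1] the identity and the square agree with bounded continuous functions obtained by
clamping. Taking x₁ = x₂ covers a deterministic limit. -/
lemma tendsto_moments_of_two_point_limit {X : ℕ → Ω → ℝ} (hX : ∀ n, Measurable (X n))
    (hb : ∀ n ω, |X n ω| ≤ 1) {x₁ x₂ : ℝ} (h₁ : |x₁| ≤ 1) (h₂ : |x₂| ≤ 1)
    (h : ∀ f : ℝ →ᵇ ℝ, Tendsto (fun n => ∫ ω, f (X n ω) ∂P) atTop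
      (𝓝 (1 / 2 * f x₁ + 1 / 2 * f x₂))) :
    Tendsto (fun n => ∫ ω, X n ω ∂P) atTop (𝓝 (1 / 2 * x₁ + 1 / 2 * x₂)) ∧
      Tendsto (fun n => Var[X n; P]) atTop
        (𝓝 (1 / 2 * x₁ ^ 2 + 1 / 2 * x₂ ^ 2 - (1 / 2 * x₁ + 1 / 2 * x₂) ^ 2)) := by
  have hclamp : ∀ x : ℝ, |x| ≤ 1 → max (-1) (min 1 x) = x := fun x hx => by
    rw [min_eq_right (abs_le.1 hx).2, max_eq_right (abs_le.1 hx).1]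
  have hbd : ∀ x : ℝ, |max (-1) (min 1 x)| ≤ 1 := fun x =>
    abs_le.2 ⟨le_max_left _ _, max_le (by norm_num) (min_le_left _ _)⟩
  let f₁ : ℝ →ᵇ ℝ := BoundedContinuousFunction.ofNormedAddCommGroup
    (fun x => max (-1) (min 1 x)) (by fun_prop) 1 hbd
  let f₂ : ℝ →ᵇ ℝ := BoundedContinuousFunction.ofNormedAddCommGroup
    (fun x => max (-1) (min 1 x) ^ 2) (by fun_prop) 1 (fun x => by
      rw [norm_pow]; exact pow_le_one₀ (norm_nonneg _) (hbd x))
  have e₁ : ∀ x, |x| ≤ 1 → f₁ x = x := hclamp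
  have e₂ : ∀ x, |x| ≤ 1 → f₂ x = x ^ 2 := fun x hx => congrArg (· ^ 2) (hclamp x hx)
  have t₁ := h f₁
  have t₂ := h f₂
  simp only [e₁ _ h₁, e₁ _ h₂, fun n ω => e₁ _ (hb n ω)] at t₁
  simp only [e₂ _ h₁, e₂ _ h₂, fun n ω => e₂ _ (hb n ω)] at t₂
  refine ⟨t₁, ?_⟩
  have hV : ∀ n, Var[X n; P] = ∫ ω, X n ω ^ 2 ∂P - (∫ ω, X n ω ∂P) ^ 2 := fun n =>
    variance_eq_sub (MemLp.of_bound (hX n).aestronglyMeasurable 1 (ae_of_all _ (hb n)))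
  simp_rw [hV]
  exact t₂.sub (t₁.pow 2)

end Moments

/-! ### Sign and size of the sum of the field -/

section CentralLimit

variable {Ω : Type*} [MeasurableSpace Ω] {P : Measure Ω} [IsProbabilityMeasure P]

lemma gaussianReal_zero_Ioi {v : NNReal} (hv : v ≠ 0) : gaussianReal 0 v (Set.Ioi 0) = 1 / 2 := by
  have := nullSingletonClass_gaussianReal (μ := 0) hv
  have h1 : gaussianReal 0 v (Set.Iio 0) = gaussianReal 0 v (Set.Ioi 0) := by
    conv_rhs => rw [← neg_zero (G := ℝ), ← gaussianReal_map_neg, Measure.map_apply (by fun_prop)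
      measurableSet_Ioi]
    congr 1
    ext x; simp
  have h2 : gaussianReal 0 v (Set.Ioi 0) + gaussianReal 0 v (Set.Ioi 0) = 1 := by
    nth_rewrite 1 [← h1]
    rw [measure_congr Iio_ae_eq_Iic, ← measure_union (by
      rw [Set.disjoint_left]; intro x hx hx'; exact absurd (Set.mem_Ioi.1 hx') (not_lt.2 (Set.mem_Iic.1 hx))) measurableSet_Ioi,
      Set.Iic_union_Ioi, measure_univ]
  rw [ENNReal.eq_div_iff two_ne_zero ENNReal.ofNat_ne_top, two_mul, h2]

variable {Y : ℕ → Ω → ℝ}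

/-- Central limit theorem and portmanteau: the limiting Gaussian has positive variance, hence no
atoms, and does not charge a countable frontier. -/
lemma tendsto_measure_scaled_sum (hL2 : MemLp (Y 0) 2 P) (hmean : ∫ ω, Y 0 ω ∂P = 0)
    (hvar : 0 < Var[Y 0; P]) (hindep : iIndepFun Y P)
    (hident : ∀ i, IdentDistrib (Y i) (Y 0) P P) {s : Set ℝ} (hs : MeasurableSet s)
    (hfr : (frontier s).Countable) :
    Tendsto (fun n : ℕ => P {ω | (√(n : ℝ))⁻¹ * ∑ k ∈ Finset.range n, Y k ω ∈ s}) atTop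
      (𝓝 (gaussianReal 0 Var[Y 0; P].toNNReal s)) := by
  have hv : Var[Y 0; P].toNNReal ≠ 0 := (Real.toNNReal_pos.2 hvar).ne'
  have := nullSingletonClass_gaussianReal (μ := 0) hv
  have h := tendstoInDistribution_inv_sqrt_mul_sum_sub
    (HasLaw.id (μ := gaussianReal 0 Var[Y 0; P].toNNReal)) hL2 hindep hident
  have ht := ProbabilityMeasure.tendsto_measure_of_null_frontier_of_tendsto' h.tendsto
    (E := s) (by simpa using hfr.measure_zero _)
  simp only [ProbabilityMeasure.coe_mk, Measure.map_id] at ht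
  refine ht.congr fun n => ?_
  rw [Measure.map_apply_of_aemeasurable (h.forall_aemeasurable n) hs]
  congr 1
  ext ω
  simp [hmean]

lemma tendsto_measure_sum_pos (hL2 : MemLp (Y 0) 2 P) (hmean : ∫ ω, Y 0 ω ∂P = 0)
    (hvar : 0 < Var[Y 0; P]) (hindep : iIndepFun Y P)
    (hident : ∀ i, IdentDistrib (Y i) (Y 0) P P) :
    Tendsto (fun n : ℕ => P {ω | 0 < ∑ k ∈ Finset.range n, Y k ω}) atTop (𝓝 (1 / 2)) := by
  have h := tendsto_measure_scaled_sum hL2 hmean hvar hindep hident (s := Set.Ioi 0)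
    measurableSet_Ioi (by rw [frontier_Ioi]; exact Set.countable_singleton 0)
  rw [gaussianReal_zero_Ioi (Real.toNNReal_pos.2 hvar).ne'] at h
  refine h.congr' ?_
  filter_upwards [eventually_gt_atTop 0] with n hn
  have hs : 0 < (√(n : ℝ))⁻¹ := inv_pos.2 (Real.sqrt_pos.2 (by exact_mod_cast hn))
  congr 1
  ext ω
  exact mul_pos_iff_of_pos_left hs

/-- For large n the event lies in |S_n|/√n ≤ δ, whose limiting Gaussian probability is small with δ.
-/
lemma tendsto_measure_abs_sum_le (hL2 : MemLp (Y 0) 2 P) (hmean : ∫ ω, Y 0 ω ∂P = 0)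
    (hvar : 0 < Var[Y 0; P]) (hindep : iIndepFun Y P)
    (hident : ∀ i, IdentDistrib (Y i) (Y 0) P P) (K : ℝ) :
    Tendsto (fun n : ℕ => P {ω | |∑ k ∈ Finset.range n, Y k ω| ≤ K}) atTop (𝓝 0) := by
  have := nullSingletonClass_gaussianReal (μ := 0) (Real.toNNReal_pos.2 hvar).ne'
  rw [ENNReal.tendsto_nhds_zero]
  intro ε hε
  have h0 := tendsto_measure_Icc (gaussianReal 0 Var[Y 0; P].toNNReal) 0
  have h0' : ∀ᶠ δ in 𝓝[>] (0 : ℝ),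
      gaussianReal 0 Var[Y 0; P].toNNReal (Set.Icc (0 - δ) (0 + δ)) < ε :=
    (h0.eventually (gt_mem_nhds hε)).filter_mono nhdsWithin_le_nhds
  obtain ⟨δ, hδ, hδ0⟩ := (h0'.and self_mem_nhdsWithin).exists
  have hδ0 : 0 < δ := hδ0
  have h := tendsto_measure_scaled_sum hL2 hmean hvar hindep hident (s := Set.Icc (0 - δ) (0 + δ))
    measurableSet_Icc (by
      rw [frontier_Icc (by linarith)]; exact ((Set.countable_singleton _).insert _))
  have hK : ∀ᶠ n : ℕ in atTop, K ≤ δ * √(n : ℝ) :=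
    ((Real.tendsto_sqrt_atTop.comp tendsto_natCast_atTop_atTop).const_mul_atTop
      hδ0).eventually_ge_atTop K
  filter_upwards [h.eventually (gt_mem_nhds hδ), hK, eventually_gt_atTop 0] with n hn hKn hn0
  refine (measure_mono fun ω hω => ?_).trans hn.le
  have hs : 0 < √(n : ℝ) := Real.sqrt_pos.2 (by exact_mod_cast hn0)
  have hω' : |∑ k ∈ Finset.range n, Y k ω| ≤ K := hω
  rw [Set.mem_ofPred_eq, zero_sub, zero_add, Set.mem_Icc, ← abs_le, abs_mul, abs_inv,
    abs_of_pos hs, inv_mul_le_iff₀ hs]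
  linarith

end CentralLimit

end MeanFieldSpherical

/-! ### Limit laws of the magnetization density -/

namespace MeanFieldSpherical

open scoped ENNReal

/-- In the mixed range the relevant convergence holds in probability rather than along fixed
samples, so the Laplace limit is needed with thresholds uniform in n and in the parameters. -/
lemma exists_uniform_near_pair {β J : ℝ} (hβ : 0 < β) (hJ : 0 < J) {m : ℝ × ℝ} (hm1 : m.1 = 0)
    {x : ℝ} (hx0 : 0 < x) (hx : |x| ≤ 1)
    (hmax : ∀ ζ, (∀ ζ', planeTilting β J m ζ' ≤ planeTilting β J m ζ) → |(gnomonic ζ).1| = x)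
    {δ : ℝ} (hδ : 0 < δ) :
    ∃ (N : ℕ) (r K : ℝ), 0 < r ∧ ∀ n ≥ N, ∀ p : ℝ × ℝ, dist p m < r →
      (K < n * p.1 → dist (planeMagnetization n β J p) x < δ) ∧
      (n * p.1 < -K → dist (planeMagnetization n β J p) (-x) < δ) := by
  -- Applying the limit theorem along the filter pulled back by g encodes "n large, p near m, n
  -- times p₁ large" at once; unfolding it produces N, r and K.
  let g : ℕ × (ℝ × ℝ) → ℕ × (ℝ × ℝ) × ℝ := fun q => (q.1, q.2, q.1 * q.2.1)
  have hg : Tendsto g (comap g (atTop ×ˢ 𝓝 m ×ˢ atTop)) (atTop ×ˢ 𝓝 m ×ˢ atTop) := tendsto_comap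
  have ht := tendsto_planeMagnetization_of_pair hβ hJ hx0 hx hmax (tendsto_fst.comp hg)
    (tendsto_fst.comp (tendsto_snd.comp hg)) (tendsto_snd.comp (tendsto_snd.comp hg))
  obtain ⟨t, htm, hts⟩ := mem_comap.1 (ht (Metric.ball_mem_nhds x hδ))
  obtain ⟨A, hA, B, hB, hAB⟩ := mem_prod_iff.1 htm
  obtain ⟨U, hU, C, hC, hUC⟩ := mem_prod_iff.1 hB
  obtain ⟨N, hN⟩ := mem_atTop_sets.1 hA
  obtain ⟨r, hr, hrU⟩ := Metric.mem_nhds_iff.1 hU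
  obtain ⟨K, hK⟩ := mem_atTop_sets.1 hC
  have key : ∀ n ≥ N, ∀ p : ℝ × ℝ, dist p m < r → K < n * p.1 →
      dist (planeMagnetization n β J p) x < δ := fun n hn p hp hKp =>
    hts (a := (n, p)) (hAB ⟨hN n hn, hUC ⟨hrU hp, hK _ hKp.le⟩⟩)
  -- The negative side follows by reflection, which fixes m because its first coordinate vanishes.
  refine ⟨N, r, K, hr, fun n hn p hp => ⟨key n hn p hp, fun hKp => ?_⟩⟩
  have h1 : dist (reflectFst p) m < r := by
    rw [Prod.dist_eq, hm1, Real.dist_eq, Real.dist_eq, reflectFst_apply] at *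
    simpa using hp
  have h2 := key n hn (reflectFst p) h1 (by rw [reflectFst_apply]; simp only; linarith)
  rw [planeMagnetization_reflectFst, Real.dist_eq] at h2
  rw [Real.dist_eq, ← abs_neg]
  convert h2 using 2
  ring

section Field

variable {Ω Ω₀ : Type*} [MeasurableSpace Ω] [MeasurableSpace Ω₀] {P : Measure Ω}
  [IsProbabilityMeasure P] {P₀ : Measure Ω₀} [IsProbabilityMeasure P₀] {h : Ω → ℕ → ℝ}
  {h₀ : Ω₀ → ℝ}

lemma measurable_sampleMean (n : ℕ) : Measurable (sampleMean n) := by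
  unfold sampleMean; fun_prop

lemma measurable_sampleStd (n : ℕ) : Measurable (sampleStd n) := by
  have := measurable_sampleMean n
  unfold sampleStd; fun_prop

/-- Strong law of large numbers for the sample mean and standard deviation. -/
theorem ae_tendsto_sample (hA1 : AssumptionA1 P h P₀ h₀) :
    ∀ᵐ ω ∂P, Tendsto (fun n => (sampleMean n (h ω), sampleStd n (h ω))) atTop
      (𝓝 (fieldParameters P₀ h₀)) := by
  have hid : ∀ i, IdentDistrib (fun ω => h ω i) (fun ω => h ω 0) P P := fun i =>
    (hA1.identDistrib i).trans (hA1.identDistrib 0).symm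
  have hL2 : MemLp (fun ω => h ω 0) 2 P := (hA1.identDistrib 0).memLp_iff.2 hA1.memLp_two
  have h1 := strong_law_ae_real (fun (i : ℕ) (ω : Ω) => h ω i) (hL2.integrable one_le_two)
    (fun i j hij => hA1.indep.indepFun hij) hid
  have h2 := strong_law_ae_real (fun (i : ℕ) (ω : Ω) => h ω i ^ 2) hL2.integrable_sq
    (fun i j hij => (hA1.indep.indepFun hij).comp (φ := fun x => x ^ 2) (ψ := fun x => x ^ 2)
      (by fun_prop) (by fun_prop)) fun i => (hid i).sq
  have e1 : ∫ ω, h ω 0 ∂P = ∫ ω, h₀ ω ∂P₀ := (hA1.identDistrib 0).integral_eq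
  have e2 : ∫ ω, h ω 0 ^ 2 ∂P = ∫ ω, h₀ ω ^ 2 ∂P₀ := (hA1.identDistrib 0).sq.integral_eq
  filter_upwards [h1, h2] with ω hω1 hω2
  rw [e1] at hω1
  rw [e2] at hω2
  have hv : Var[h₀; P₀] = ∫ ω, h₀ ω ^ 2 ∂P₀ - (∫ ω, h₀ ω ∂P₀) ^ 2 := variance_eq_sub hA1.memLp_two
  refine hω1.prodMk_nhds ?_
  rw [hv]
  exact (Real.continuous_sqrt.tendsto _).comp (hω2.sub (hω1.pow 2))

theorem tendsto_integral_of_singleton (hmeas : Measurable h) (hA1 : AssumptionA1 P h P₀ h₀)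
    {β J : ℝ} (hβ : 0 < β) (hJ : 0 < J) {z : ℝ × ℝ}
    (hz : maximizers β J (fieldParameters P₀ h₀) = {z}) (f : ℝ →ᵇ ℝ) :
    Tendsto (fun n => ∫ ω, f (magnetizationDensity n β J (h ω)) ∂P) atTop (𝓝 (f z.1)) := by
  have hzm : z ∈ maximizers β J (fieldParameters P₀ h₀) := by rw [hz]; rfl
  have hlim : Tendsto (fun n => ∫ ω, f (magnetizationDensity n β J (h ω)) ∂P) atTop
      (𝓝 (∫ _, f z.1 ∂P)) := by
    refine tendsto_integral_of_dominated_convergence (fun _ => ‖f‖) (fun n =>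
      (f.continuous.measurable.comp
        ((measurable_magnetizationDensity n β J).comp hmeas)).aestronglyMeasurable)
      (integrable_const _) (fun n => ae_of_all _ fun ω => f.norm_coe_le_norm _) ?_
    filter_upwards [ae_tendsto_sample hA1] with ω hω
    refine (f.continuous.tendsto _).comp ?_
    refine (tendsto_planeMagnetization_of_unique hβ hJ (abs_le_one_of_mem_unitDisc hzm.1).1
      (fun ζ hζ => ?_) tendsto_id hω).congr' ?_
    · have := gnomonic_mem_maximizers hζ
      rw [hz] at this
      rw [Set.mem_singleton_iff.1 this]
    · filter_upwards [eventually_ge_atTop 3] with n hn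
      exact (magnetizationDensity_eq_planeMagnetization hn β J (h ω)).symm
  simpa using hlim

/-- With high probability the magnetization density is close to x or -x according to the sign of the
field sum, so its law is compared with that of this random sign times x. -/
theorem tendsto_integral_of_pair (hmeas : Measurable h) (hA1 : AssumptionA1 P h P₀ h₀)
    {β J : ℝ} (hβ : 0 < β) (hJ : 0 < J) (hm1 : (fieldParameters P₀ h₀).1 = 0) {z : ℝ × ℝ}
    (hz0 : 0 < z.1) (hz : maximizers β J (fieldParameters P₀ h₀) = {z, (-z.1, z.2)})
    (f : ℝ →ᵇ ℝ) :
    Tendsto (fun n => ∫ ω, f (magnetizationDensity n β J (h ω)) ∂P) atTop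
      (𝓝 (1 / 2 * f z.1 + 1 / 2 * f (-z.1))) := by
  set m := fieldParameters P₀ h₀ with hm
  have hzm : z ∈ maximizers β J m := by rw [hz]; exact Or.inl rfl
  have hmax : ∀ ζ, (∀ ζ', planeTilting β J m ζ' ≤ planeTilting β J m ζ) →
      |(gnomonic ζ).1| = z.1 := fun ζ hζ => by
    have := gnomonic_mem_maximizers hζ
    rw [hz] at this
    rcases this with h | h <;> rw [h]
    · exact abs_of_pos hz0
    · simp only [abs_neg]; exact abs_of_pos hz0
  have hid : ∀ i, IdentDistrib (fun ω => h ω i) (fun ω => h ω 0) P P := fun i =>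
    (hA1.identDistrib i).trans (hA1.identDistrib 0).symm
  have hL2 : MemLp (fun ω => h ω 0) 2 P := (hA1.identDistrib 0).memLp_iff.2 hA1.memLp_two
  have hmean : ∫ ω, h ω 0 ∂P = 0 := (hA1.identDistrib 0).integral_eq.trans hm1
  have hvar : 0 < Var[fun ω => h ω 0; P] := by
    rw [(hA1.identDistrib 0).variance_eq]; exact hA1.variance_pos
  have hpos := tendsto_measure_sum_pos (Y := fun i ω => h ω i) hL2 hmean hvar hA1.indep hid
  have hsmall := tendsto_measure_abs_sum_le (Y := fun i ω => h ω i) hL2 hmean hvar hA1.indep hid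
  set S : ℕ → Ω → ℝ := fun n ω => ∑ k ∈ Finset.range n, h ω k
  set X : ℕ → Ω → ℝ := fun n ω => magnetizationDensity n β J (h ω)
  set p : ℕ → Ω → ℝ × ℝ := fun n ω => (sampleMean n (h ω), sampleStd n (h ω))
  have hSm : ∀ n, Measurable (S n) := fun n => by fun_prop
  have hXm : ∀ n, Measurable (X n) := fun n => (measurable_magnetizationDensity n β J).comp hmeas
  have hpm : ∀ n, Measurable (p n) := fun n =>
    ((measurable_sampleMean n).comp hmeas).prodMk ((measurable_sampleStd n).comp hmeas)
  have hSpos : ∀ n, MeasurableSet {ω | 0 < S n ω} := fun n => measurableSet_lt (by fun_prop) (hSm n)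
  -- Then f(-x) + Y is f(x) when the field sum is positive and f(-x) otherwise.
  set Y : ℕ → Ω → ℝ := fun n => {ω | 0 < S n ω}.indicator fun _ => f z.1 - f (-z.1)
  have hYint : ∀ n, Integrable (Y n) P := fun n => (integrable_const _).indicator (hSpos n)
  have hY : Tendsto (fun n => ∫ ω, (f (-z.1) + Y n ω) ∂P) atTop
      (𝓝 (1 / 2 * f z.1 + 1 / 2 * f (-z.1))) := by
    have h1 : Tendsto (fun n => P.real {ω | 0 < S n ω}) atTop (𝓝 (1 / 2)) := by
      have := (ENNReal.tendsto_toReal (by simp : (1 / 2 : ℝ≥0∞) ≠ ∞)).comp hpos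
      rw [ENNReal.toReal_div, ENNReal.toReal_one, ENNReal.toReal_ofNat] at this
      exact this
    have h2 := (h1.mul_const (f z.1 - f (-z.1))).const_add (f (-z.1))
    convert h2 using 2 with n
    · rw [integral_add (integrable_const _) (hYint n), integral_indicator_const _ (hSpos n)]
      simp
    · ring
  have hfint : ∀ n, Integrable (fun ω => f (X n ω)) P := fun n =>
    Integrable.of_bound (f.continuous.measurable.comp (hXm n)).aestronglyMeasurable ‖f‖
      (ae_of_all _ fun ω => f.norm_coe_le_norm _)
  have hdiff : Tendsto (fun n => ∫ ω, f (X n ω) ∂P - ∫ ω, (f (-z.1) + Y n ω) ∂P) atTop (𝓝 0) := by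
    rw [Metric.tendsto_nhds]
    intro ε hε
    obtain ⟨δ₁, hδ₁, hf₁⟩ := Metric.continuous_iff.1 f.continuous z.1 (ε / 2) (by positivity)
    obtain ⟨δ₂, hδ₂, hf₂⟩ := Metric.continuous_iff.1 f.continuous (-z.1) (ε / 2) (by positivity)
    obtain ⟨N, r, K, hr, hN⟩ := exists_uniform_near_pair hβ hJ hm1 hz0
      (abs_le_one_of_mem_unitDisc hzm.1).1 hmax (lt_min hδ₁ hδ₂)
    -- Exceptional event: the field sum is too small to select a peak, or the sample parameters are
    -- far from m. Both have vanishing probability, and f is bounded there.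
    set B : ℕ → Set Ω := fun n => {ω | |S n ω| ≤ |K|} ∪ {ω | r ≤ dist (p n ω) m}
    have hBm : ∀ n, MeasurableSet (B n) := fun n =>
      (measurableSet_le (hSm n).abs measurable_const).union
        (measurableSet_le measurable_const ((hpm n).dist measurable_const))
    have hB : Tendsto (fun n => 2 * ‖f‖ * P.real (B n)) atTop (𝓝 0) := by
      have h1 := tendstoInMeasure_iff_dist.1 (tendstoInMeasure_of_tendsto_ae
        (fun n => (hpm n).aestronglyMeasurable) (ae_tendsto_sample hA1)) r hr
      have h2 := (hsmall |K|).add h1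
      rw [add_zero] at h2
      have h3 : Tendsto (fun n => P (B n)) atTop (𝓝 0) :=
        tendsto_of_tendsto_of_tendsto_of_le_of_le tendsto_const_nhds h2 (fun _ => zero_le)
          fun n => measure_union_le _ _
      have h4 := (ENNReal.tendsto_toReal ENNReal.zero_ne_top).comp h3
      have h5 := h4.const_mul (2 * ‖f‖)
      rw [ENNReal.toReal_zero, mul_zero] at h5
      exact h5
    filter_upwards [hB.eventually (gt_mem_nhds (show 0 < ε / 2 by positivity)),
      eventually_ge_atTop N, eventually_ge_atTop 3] with n hBn hnN hn3
    have hYi : Integrable (fun ω => f (-z.1) + Y n ω) P := (integrable_const _).add (hYint n)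
    rw [Real.dist_eq, sub_zero, ← integral_sub (hfint n) hYi]
    refine (abs_integral_le_integral_abs).trans_lt ?_
    have hbound : ∀ ω, |f (X n ω) - (f (-z.1) + Y n ω)| ≤
        ε / 2 + (B n).indicator (fun _ => 2 * ‖f‖) ω := by
      intro ω
      have hval : f (-z.1) + Y n ω = if 0 < S n ω then f z.1 else f (-z.1) := by
        by_cases hS : 0 < S n ω
        · rw [if_pos hS]
          simp only [Y]
          rw [Set.indicator_of_mem (by exact hS)]; ring
        · rw [if_neg hS]
          simp only [Y]
          rw [Set.indicator_of_notMem (by exact hS), add_zero]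
      rw [hval]
      by_cases hω : ω ∈ B n
      · rw [Set.indicator_of_mem hω]
        have h1 := f.dist_le_two_norm (X n ω) z.1
        have h2 := f.dist_le_two_norm (X n ω) (-z.1)
        rw [Real.dist_eq] at h1 h2
        split_ifs <;> linarith
      · rw [Set.indicator_of_notMem hω, add_zero]
        have hSK : |K| < |S n ω| := not_le.1 fun h' => hω (Or.inl h')
        have hp : dist (p n ω) m < r := not_le.1 fun h' => hω (Or.inr h')
        have hnp : n * (p n ω).1 = S n ω := by
          have : (n : ℝ) ≠ 0 := by positivity
          simp only [p, sampleMean, S]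
          field_simp
        have hXp : X n ω = planeMagnetization n β J (p n ω) :=
          magnetizationDensity_eq_planeMagnetization hn3 β J (h ω)
        obtain ⟨h1, h2⟩ := hN n hnN _ hp
        rw [hnp, ← hXp] at h1 h2
        split_ifs with hS
        · rw [abs_of_pos hS] at hSK
          exact (hf₁ _ ((h1 ((le_abs_self K).trans_lt hSK)).trans_le (min_le_left _ _))).le
        · rw [abs_of_nonpos (not_lt.1 hS)] at hSK
          exact (hf₂ _ ((h2 (by linarith [le_abs_self K])).trans_le (min_le_right _ _))).le
    have hgi : Integrable (fun ω => ε / 2 + (B n).indicator (fun _ => 2 * ‖f‖) ω) P :=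
      (integrable_const _).add ((integrable_const _).indicator (hBm n))
    calc ∫ ω, |f (X n ω) - (f (-z.1) + Y n ω)| ∂P
        ≤ ∫ ω, (ε / 2 + (B n).indicator (fun _ => 2 * ‖f‖) ω) ∂P :=
          integral_mono_of_nonneg (ae_of_all _ fun _ => abs_nonneg _) hgi (ae_of_all _ hbound)
      _ = ε / 2 + 2 * ‖f‖ * P.real (B n) := by
          rw [integral_add (integrable_const _) ((integrable_const _).indicator (hBm n)),
            integral_indicator_const _ (hBm n)]
          simp [mul_comm]
      _ < ε := by linarith
  simpa using hdiff.add hY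

end Field

end MeanFieldSpherical

/-! ### Assembly of the phase diagram -/

theorem mainTheorem11 {Ω Ω₀ : Type*} [MeasurableSpace Ω] [MeasurableSpace Ω₀]
    (P : Measure Ω) [IsProbabilityMeasure P] (P₀ : Measure Ω₀) [IsProbabilityMeasure P₀]
    (h : Ω → ℕ → ℝ) (hmeas : Measurable h) (h₀ : Ω₀ → ℝ)
    (hA1 : MeanFieldSpherical.AssumptionA1 P h P₀ h₀)
    (hA2 : MeanFieldSpherical.AssumptionA2 P₀ h₀)
    (β J : ℝ) (hβ : 0 < β) (hJ : 0 < J)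
    (m : ℝ × ℝ) (hm : m = MeanFieldSpherical.fieldParameters P₀ h₀)
    (X : ℕ → Ω → ℝ)
    (hX : X = fun n ω => MeanFieldSpherical.magnetizationDensity n β J (h ω)) :
    -- the magnetization densities are random variables with finite mean and variance
    (∀ n, MemLp (X n) 2 P) ∧
    -- pure state range
    (MeanFieldSpherical.PureStateRange β J m →
      ∃ z : ℝ × ℝ, MeanFieldSpherical.maximizers β J m = {z} ∧
        (∀ f : ℝ →ᵇ ℝ, Tendsto (fun n => ∫ ω, f (X n ω) ∂P) atTop (𝓝 (f z.1))) ∧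
        Tendsto (fun n => ∫ ω, X n ω ∂P) atTop (𝓝 z.1) ∧
        Tendsto (fun n => Var[X n; P]) atTop (𝓝 0)) ∧
    -- mixed state range
    (MeanFieldSpherical.MixedStateRange β J m →
      ∃ zp zm : ℝ × ℝ, MeanFieldSpherical.maximizers β J m = {zp, zm} ∧
        0 < zp.1 ∧ zm.1 = -zp.1 ∧ zm.2 = zp.2 ∧
        (∀ f : ℝ →ᵇ ℝ, Tendsto (fun n => ∫ ω, f (X n ω) ∂P) atTop
          (𝓝 (1 / 2 * f zp.1 + 1 / 2 * f zm.1))) ∧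
        Tendsto (fun n => ∫ ω, X n ω ∂P) atTop (𝓝 0) ∧
        Tendsto (fun n => Var[X n; P]) atTop (𝓝 (zp.1 ^ 2))) ∧
    -- the parameter ranges in terms of the mean and standard deviation of the field
    (MeanFieldSpherical.PureStateRange β J m ↔
      m.1 ≠ 0 ∨ J ≤ m.2 ∨ (m.2 < J ∧ β ≤ MeanFieldSpherical.criticalBeta J m.2)) ∧
    (MeanFieldSpherical.MixedStateRange β J m ↔
      m.1 = 0 ∧ m.2 < J ∧ MeanFieldSpherical.criticalBeta J m.2 < β) ∧
    -- the three phases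
    (MeanFieldSpherical.IsOrderedFerromagnet P X ↔ m.1 ≠ 0) ∧
    (MeanFieldSpherical.IsOrderedParamagnet P X ↔
      m.1 = 0 ∧ (J ≤ m.2 ∨ (m.2 < J ∧ β ≤ MeanFieldSpherical.criticalBeta J m.2))) ∧
    (MeanFieldSpherical.IsSpinGlass P X ↔
      m.1 = 0 ∧ m.2 < J ∧ MeanFieldSpherical.criticalBeta J m.2 < β) := by

  subst hX
  have hm2 : 0 < m.2 := by rw [hm]; exact Real.sqrt_pos.2 hA1.variance_pos
  have hXm : ∀ n, Measurable fun ω => MeanFieldSpherical.magnetizationDensity n β J (h ω) :=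
    fun n => (MeanFieldSpherical.measurable_magnetizationDensity n β J).comp hmeas
  have hXb : ∀ n ω, |MeanFieldSpherical.magnetizationDensity n β J (h ω)| ≤ 1 :=
    fun n ω => MeanFieldSpherical.abs_magnetizationDensity_le_one n β J (h ω)
  have hmem : ∀ n, MemLp (fun ω => MeanFieldSpherical.magnetizationDensity n β J (h ω)) 2 P :=
    fun n => MemLp.of_bound (hXm n).aestronglyMeasurable 1 (ae_of_all _ (hXb n))
  have hsingle : ∀ z, MeanFieldSpherical.maximizers β J m = {z} →
      (∀ f : ℝ →ᵇ ℝ, Tendsto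
        (fun n => ∫ ω, f (MeanFieldSpherical.magnetizationDensity n β J (h ω)) ∂P) atTop
        (𝓝 (f z.1))) ∧
      Tendsto (fun n => ∫ ω, MeanFieldSpherical.magnetizationDensity n β J (h ω) ∂P) atTop
        (𝓝 z.1) ∧
      Tendsto (fun n => Var[fun ω => MeanFieldSpherical.magnetizationDensity n β J (h ω); P]) atTop
        (𝓝 0) := by
    intro z hz
    have hf : ∀ f : ℝ →ᵇ ℝ, _ := fun f =>
      MeanFieldSpherical.tendsto_integral_of_singleton hmeas hA1 hβ hJ (hm ▸ hz) f
    have hzm : z ∈ MeanFieldSpherical.maximizers β J m := by rw [hz]; rfl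
    have hz1 := (MeanFieldSpherical.abs_le_one_of_mem_unitDisc hzm.1).1
    -- A point mass is treated as a two-point law with coinciding atoms.
    have hmom := MeanFieldSpherical.tendsto_moments_of_two_point_limit hXm hXb hz1 hz1 (fun f => by
      convert hf f using 2; ring)
    refine ⟨hf, ?_, ?_⟩
    · convert hmom.1 using 2; ring
    · convert hmom.2 using 2; ring
  by_cases hm1 : m.1 = 0
  · obtain ⟨z, hz, hz0, hiff⟩ := MeanFieldSpherical.exists_maximizers_eq_pair hβ hJ hm1 hm2
    by_cases hC : m.2 < J ∧ MeanFieldSpherical.criticalBeta J m.2 < β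
    · have hzpos := hiff.2 hC
      have hne : z ≠ (-z.1, z.2) := fun he => by
        have := congrArg Prod.fst he
        simp only at this
        linarith
      have hcard : (MeanFieldSpherical.maximizers β J m).encard = 2 := by
        rw [hz]; exact Set.encard_pair hne
      have hnC : ¬ (J ≤ m.2 ∨ (m.2 < J ∧ β ≤ MeanFieldSpherical.criticalBeta J m.2)) := by
        rintro (h1 | ⟨_, h1⟩)
        · exact absurd hC.1 (not_lt.2 h1)
        · exact absurd hC.2 (not_lt.2 h1)
      have hnpure : ¬ MeanFieldSpherical.PureStateRange β J m := fun h1 => by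
        have h2 : (MeanFieldSpherical.maximizers β J m).encard = 1 := h1
        rw [hcard] at h2
        exact absurd h2 (by norm_num)
      have hzm : z ∈ MeanFieldSpherical.maximizers β J m := by rw [hz]; exact Or.inl rfl
      have hz1 := (MeanFieldSpherical.abs_le_one_of_mem_unitDisc hzm.1).1
      have hf : ∀ f : ℝ →ᵇ ℝ, _ := fun f =>
        MeanFieldSpherical.tendsto_integral_of_pair hmeas hA1 hβ hJ (hm ▸ hm1) hzpos (hm ▸ hz) f
      have hmom := MeanFieldSpherical.tendsto_moments_of_two_point_limit hXm hXb hz1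
        ((abs_neg z.1).trans_le hz1) hf
      have hmean : Tendsto (fun n => ∫ ω, MeanFieldSpherical.magnetizationDensity n β J (h ω) ∂P)
          atTop (𝓝 0) := by
        convert hmom.1 using 2; ring
      have hvar : Tendsto
          (fun n => Var[fun ω => MeanFieldSpherical.magnetizationDensity n β J (h ω); P]) atTop
          (𝓝 (z.1 ^ 2)) := by
        convert hmom.2 using 2; ring
      have hv0 : 0 < z.1 ^ 2 := pow_pos hzpos 2
      refine ⟨hmem, fun h1 => absurd h1 hnpure, fun _ => ⟨z, (-z.1, z.2), hz, hzpos, rfl, rfl, hf,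
        hmean, hvar⟩, ⟨fun h1 => absurd h1 hnpure, fun h1 => ?_⟩, ⟨fun _ => ⟨hm1, hC⟩, fun _ => hcard⟩,
        ⟨fun h1 => ?_, fun h1 => absurd hm1 h1⟩, ⟨fun h1 => ?_, fun h1 => absurd h1.2 hnC⟩,
        ⟨fun _ => ⟨hm1, hC⟩, fun _ => ⟨hmean, _, hv0, hvar⟩⟩⟩
      · exact absurd (h1.resolve_left (not_not.2 hm1)) hnC
      · exact absurd (tendsto_nhds_unique hvar h1.2) hv0.ne'
      · exact absurd (tendsto_nhds_unique hvar h1.2) hv0.ne'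
    · have hC' : J ≤ m.2 ∨ (m.2 < J ∧ β ≤ MeanFieldSpherical.criticalBeta J m.2) := by
        rcases le_or_gt J m.2 with h1 | h1
        · exact Or.inl h1
        · exact Or.inr ⟨h1, not_lt.1 fun h2 => hC ⟨h1, h2⟩⟩
      -- Outside the low-temperature region the two symmetric maximizers coincide on the axis x = 0.
      have hz1 : z.1 = 0 := le_antisymm (not_lt.1 fun h1 => hC (hiff.1 h1)) hz0
      have hz' : MeanFieldSpherical.maximizers β J m = {z} := by
        have : (-z.1, z.2) = z := Prod.ext (by simp [hz1]) rfl
        rw [hz, this, Set.pair_eq_singleton]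
      have hpure : MeanFieldSpherical.PureStateRange β J m := by
        rw [MeanFieldSpherical.PureStateRange, hz', Set.encard_singleton]
      have hnmixed : ¬ MeanFieldSpherical.MixedStateRange β J m := fun h1 => by
        have h2 : (MeanFieldSpherical.maximizers β J m).encard = 2 := h1
        rw [hz', Set.encard_singleton] at h2
        exact absurd h2 (by norm_num)
      obtain ⟨hf, hmean, hvar⟩ := hsingle z hz'
      have hmean' := hmean
      rw [hz1] at hmean'
      refine ⟨hmem, fun _ => ⟨z, hz', hf, hmean, hvar⟩, fun h1 => absurd h1 hnmixed,
        ⟨fun _ => Or.inr hC', fun _ => hpure⟩,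
        ⟨fun h1 => absurd h1 hnmixed, fun h1 => absurd h1.2 hC⟩,
        ⟨?_, fun h1 => absurd hm1 h1⟩, ⟨fun _ => ⟨hm1, hC'⟩, fun _ => ⟨hmean', hvar⟩⟩,
        ⟨?_, fun h1 => absurd h1.2 hC⟩⟩
      · rintro ⟨⟨c, hc, hc'⟩, _⟩
        exact absurd (tendsto_nhds_unique hc' hmean') hc
      · rintro ⟨_, v, hv, hv'⟩
        exact absurd (tendsto_nhds_unique hv' hvar) hv.ne'
  · obtain ⟨z, hz, hz1⟩ := MeanFieldSpherical.exists_maximizers_eq_singleton hβ hJ hm1 hm2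
    have hpure : MeanFieldSpherical.PureStateRange β J m := by
      rw [MeanFieldSpherical.PureStateRange, hz, Set.encard_singleton]
    have hnmixed : ¬ MeanFieldSpherical.MixedStateRange β J m := fun h1 => by
      have h2 : (MeanFieldSpherical.maximizers β J m).encard = 2 := h1
      rw [hz, Set.encard_singleton] at h2
      exact absurd h2 (by norm_num)
    obtain ⟨hf, hmean, hvar⟩ := hsingle z hz
    refine ⟨hmem, fun _ => ⟨z, hz, hf, hmean, hvar⟩, fun h1 => absurd h1 hnmixed,
      ⟨fun _ => Or.inl hm1, fun _ => hpure⟩,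
      ⟨fun h1 => absurd h1 hnmixed, fun h1 => absurd h1.1 hm1⟩,
      ⟨fun _ => hm1, fun _ => ⟨⟨z.1, hz1, hmean⟩, hvar⟩⟩, ⟨?_, fun h1 => absurd h1.1 hm1⟩,
      ⟨?_, fun h1 => absurd h1.1 hm1⟩⟩
    · rintro ⟨h1, _⟩
      exact absurd (tendsto_nhds_unique hmean h1) hz1
    · rintro ⟨h1, _⟩
      exact absurd (tendsto_nhds_unique hmean h1) hz1
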